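/- Let $K$ be a number field, let $V$ be the set of all places of $K$ with normalized absolute values $|\cdot|_v$ $(v\in V)$, and let $\mathrm{Arch}\subset V$ be the set of Archimedean places. Let $S$ be a set containing (copies of) $K$ and $\mathbb{R}$, and let $S\to{}^*S$ be a countably saturated nonstandard extension: every finitary function and relation on $S$ has an extension to ${}^*S$ so that the Transfer Principle holds for all first-order statements about them, and every sequence of internal (definable with parameters) subsets of ${}^*S$ with the finite intersection property has nonempty intersection. This gives a ring ${}^*K\supset K$, an ordered ring ${}^*\mathbb{R}\supset\mathbb{R}$ and maps $|\cdot|_v:{}^*K\to{}^*\mathbb{R}$ for $v\in V$. Endow ${}^*K$ with the uniform structure generated by the entourages $\{(x,y) : |x-y|_v<\varepsilon\}$ for $v\in V$ and standard real $\varepsilon>0$. Put $$\mathrm{fin}_V({}^*K)=\{x\in{}^*K : \text{for every } v\in V \text{ there is } r\in\mathbb{R} \text{ with } |x|_v<r\},$$ and, for finite $T\subset V$, $$\mathrm{fin}_{V,T}({}^*K)=\{x\in\mathrm{fin}_V({}^*K) : |x|_v\le 1 \text{ for all } v\in V\setminus(T\cup\mathrm{Arch})\}$$ with the subspace topology of ${}^*K$.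 Let $$\mathrm{fin}'_V({}^*K)=\varinjlim_T\mathrm{fin}_{V,T}({}^*K)=\bigcup_T\mathrm{fin}_{V,T}({}^*K)$$ carry the final topology with respect to the inclusions of the $\mathrm{fin}_{V,T}({}^*K)$, and let $$\mathrm{inf}_V({}^*K)=\{x\in{}^*K : |x|_v<\varepsilon \text{ for all } v\in V \text{ and all standard real } \varepsilon>0\}.$$ Let $A_K$ be the adele ring of $K$. Then $\mathrm{fin}'_V({}^*K)$ is a locally quasi-compact topological ring, and $\mathrm{inf}_V({}^*K)$ is an ideal of it and equals the closure of $\{0\}$. There is a continuous surjective ring homomorphism $\Phi:\mathrm{fin}'_V({}^*K)\to A_K$ with kernel $\mathrm{inf}_V({}^*K)$, which takes standard parts at all places: for $v\in V$, $k\in K$ and real $\varepsilon$, if $|\Phi(x)_v-k|_v<\varepsilon$ in $K_v$, then $|x-k|_v<\varepsilon$ in ${}^*\mathbb{R}$. It induces an isomorphism of topological rings $$\mathrm{fin}'_V({}^*K)/\mathrm{inf}_V({}^*K)\cong A_K .$$ Moreover $A_K$ is the Hausdorff topological ring associated with $\mathrm{fin}'_V({}^*K)$: $\Phi$ induces an isomorphism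 of topological rings from the maximal Hausdorff quotient of $\mathrm{fin}'_V({}^*K)$ onto $A_K$. -/

import Mathlib

universe u w

open scoped FirstOrder

noncomputable section

/-! ### Nonstandard extensions -/

/-- The language with a symbol for every finitary function and every finitary relation on `S`. -/
def fullLanguage (S : Type u) : FirstOrder.Language.{u, u} where
  Functions n := (Fin n → S) → S
  Relations n := Set (Fin n → S)

instance fullStructure (S : Type u) : (fullLanguage S).Structure S where
  funMap f x := f x
  RelMap {n} R x := (show Set (Fin n → S) from R) x

/-- A countably saturated nonstandard extension of the base set `S`: a structure `*S` in which every
finitary function and relation on `S` has an extension, together with an embedding `S → *S` that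
satisfies the Transfer Principle (it is elementary for the full language of `S`), such that every
sequence of internal subsets of `*S` (i.e. those defined by a formula with
parameters in `*S`) with the finite intersection property has nonempty intersection. -/
structure NonstandardExtension (S : Type u) where
  carrier : Type w
  [str : (fullLanguage S).Structure carrier]
  emb : S ↪ₑ[fullLanguage S] carrier
  countably_saturated : ∀ A : ℕ → Set carrier,
    (∀ n, (Set.univ : Set carrier).Definable₁ (fullLanguage S) (A n)) →
    (∀ n, (⋂ k ≤ n, A k).Nonempty) → (⋂ n, A n).Nonempty

namespace NonstandardExtension

attribute [instance] NonstandardExtension.str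

variable {S : Type u} (E : NonstandardExtension.{u, w} S)

def funSymbol {n : ℕ} (f : (Fin n → S) → S) : (fullLanguage S).Functions n := f

def relSymbol {n : ℕ} (R : Set (Fin n → S)) : (fullLanguage S).Relations n := R

variable {X Y Z : Type*} (i : X ↪ S) (j : Y ↪ S) (l : Z ↪ S)

/-- `X`, included in `S` by `i`, as a unary relation symbol. -/
def domSymbol : (fullLanguage S).Relations 1 := relSymbol {s | s 0 ∈ Set.range i}

/-- The relation on `S` carried over from a relation on `X ⊆ S`. -/
def imageSymbol {n : ℕ} (R : Set (Fin n → X)) : (fullLanguage S).Relations n :=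
  relSymbol {s | ∃ p ∈ R, s = i ∘ p}

/-- A function `Xⁿ → Y`, extended arbitrarily to a function `Sⁿ → S`. -/
def extendSymbol [Nonempty Y] {n : ℕ} (f : (Fin n → X) → Y) : (fullLanguage S).Functions n :=
  funSymbol (Function.extend (fun p => i ∘ p) (fun p => j (f p)) fun _ => j (Classical.arbitrary Y))

/-- The nonstandard extension `*X ⊆ *S` of a set `X`, included in `S` by `i`. -/
def Star : Type w := {x : E.carrier // FirstOrder.Language.Structure.RelMap (domSymbol i) ![x]}

variable {E i j l}

theorem comp_injective (n : ℕ) : Function.Injective (fun p : Fin n → X => i ∘ p) :=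
  i.injective.comp_left

theorem extendSymbol_apply [Nonempty Y] {n : ℕ} (f : (Fin n → X) → Y) (p : Fin n → X) :
    FirstOrder.Language.Structure.funMap (extendSymbol i j f) (i ∘ p) = j (f p) :=
  (comp_injective (i := i) n).extend_apply (fun p => j (f p)) (fun _ => j (Classical.arbitrary Y)) p

theorem relMap_domSymbol (s : S) :
    FirstOrder.Language.Structure.RelMap (domSymbol i) ![s] ↔ s ∈ Set.range i := Iff.rfl

theorem relMap_imageSymbol {n : ℕ} (R : Set (Fin n → X)) (p : Fin n → X) :
    FirstOrder.Language.Structure.RelMap (imageSymbol i R) (i ∘ p) ↔ p ∈ R :=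
  ⟨fun ⟨_, hq, h⟩ => (comp_injective (i := i) n h) ▸ hq, fun h => ⟨p, h, rfl⟩⟩

/-- The Transfer Principle for statements of the form `∀ x ∈ Xⁿ, φ(x)`. -/
theorem transfer {n : ℕ} (φ : (fullLanguage S).Formula (Fin n))
    (h : ∀ p : Fin n → X, φ.Realize (i ∘ p)) (x : Fin n → E.Star i) :
    φ.Realize (fun k => (x k).1) := by
  let ψ : (fullLanguage S).Formula (Empty ⊕ Fin n) :=
    ((FirstOrder.Language.Formula.iInf fun k : Fin n =>
      (FirstOrder.Language.Relations.formula₁ (domSymbol i) (FirstOrder.Language.var k))).imp φ).relabel Sum.inr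
  have hS : S ⊨ (ψ.iAlls (Fin n) : (fullLanguage S).Sentence) := by
    simp only [FirstOrder.Language.Sentence.Realize, FirstOrder.Language.Formula.realize_iAlls]
    intro s
    simp only [ψ, FirstOrder.Language.Formula.realize_relabel, FirstOrder.Language.Formula.realize_imp,
      FirstOrder.Language.Formula.realize_iInf, FirstOrder.Language.Formula.realize_rel₁]
    intro hs
    choose p hp using fun k => (relMap_domSymbol (i := i) _).1 (hs k)
    have : i ∘ p = (Sum.elim (default : Empty → S) s ∘ Sum.inr) := by
      funext k; simpa using hp k
    exact this ▸ h p
  have hE := (E.emb.map_sentence (ψ.iAlls (Fin n))).1 hS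
  simp only [FirstOrder.Language.Sentence.Realize, FirstOrder.Language.Formula.realize_iAlls] at hE
  have := hE (fun k => (x k).1)
  simp only [ψ, FirstOrder.Language.Formula.realize_relabel, FirstOrder.Language.Formula.realize_imp,
      FirstOrder.Language.Formula.realize_iInf, FirstOrder.Language.Formula.realize_rel₁] at this
  exact this fun k => (x k).2


variable (E i j) in
/-- The extension `*f : (*X)ⁿ → *Y` of a function `f : Xⁿ → Y`. -/
def starFun [Nonempty Y] {n : ℕ} (f : (Fin n → X) → Y) (x : Fin n → E.Star i) : E.Star j :=
  ⟨FirstOrder.Language.Structure.funMap (extendSymbol i j f) (fun k => (x k).1), by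
    have := transfer (E := E) (i := i) (FirstOrder.Language.Relations.formula₁ (domSymbol j)
      (FirstOrder.Language.Term.func (extendSymbol i j f) FirstOrder.Language.var)) (fun p => by
        rw [FirstOrder.Language.Formula.realize_rel₁, FirstOrder.Language.Term.realize_func]
        exact ⟨f p, (extendSymbol_apply f p).symm⟩) x
    rwa [FirstOrder.Language.Formula.realize_rel₁, FirstOrder.Language.Term.realize_func] at this⟩

variable (E i) in
/-- The extension `*R` of a relation `R ⊆ Xⁿ`. -/
def starRel {n : ℕ} (R : Set (Fin n → X)) : Set (Fin n → E.Star i) :=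
  {x | FirstOrder.Language.Structure.RelMap (imageSymbol i R) (fun k => (x k).1)}

variable (E i) in
/-- The canonical inclusion `X → *X`. -/
def embed (a : X) : E.Star i :=
  ⟨E.emb (i a), by
    have h : FirstOrder.Language.Structure.RelMap (domSymbol i) ![i a] := ⟨a, rfl⟩
    rw [← E.emb.map_rel] at h
    convert h using 1
    funext k; fin_cases k; rfl⟩

theorem starFun_comp [Nonempty Y] [Nonempty Z] {m n : ℕ} (g : (Fin m → Y) → Z)
    (f : Fin m → (Fin n → X) → Y) (x : Fin n → E.Star i) :
    E.starFun j l g (fun k => E.starFun i j (f k) x) =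
      E.starFun i l (fun p => g fun k => f k p) x := by
  have := transfer (E := E) (i := i) (FirstOrder.Language.Term.equal
    (FirstOrder.Language.Term.func (extendSymbol j l g) fun k =>
      FirstOrder.Language.Term.func (extendSymbol i j (f k)) FirstOrder.Language.var)
    (FirstOrder.Language.Term.func (extendSymbol i l (fun p => g fun k => f k p))
      FirstOrder.Language.var)) (fun p => by
        simp only [FirstOrder.Language.Formula.realize_equal,
          FirstOrder.Language.Term.realize_func, FirstOrder.Language.Term.realize_var]
        have h (k) : FirstOrder.Language.Structure.funMap (extendSymbol i j (f k))
          (fun a => (i ∘ p) a) = j (f k p) := extendSymbol_apply (f k) p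
        simp only [h]
        exact (extendSymbol_apply g fun k => f k p).trans
          (extendSymbol_apply (fun p => g fun k => f k p) p).symm) x
  simp only [FirstOrder.Language.Formula.realize_equal,
    FirstOrder.Language.Term.realize_func, FirstOrder.Language.Term.realize_var] at this
  exact Subtype.ext this

theorem starFun_proj [Nonempty X] {n : ℕ} (k : Fin n) (x : Fin n → E.Star i) :
    E.starFun i i (fun p => p k) x = x k := by
  have := transfer (E := E) (i := i) (FirstOrder.Language.Term.equal
    (FirstOrder.Language.Term.func (extendSymbol i i fun p : Fin n → X => p k)
      FirstOrder.Language.var) (FirstOrder.Language.var k)) (fun p => by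
        simp only [FirstOrder.Language.Formula.realize_equal,
          FirstOrder.Language.Term.realize_func, FirstOrder.Language.Term.realize_var]
        exact extendSymbol_apply (fun p : Fin n → X => p k) p) x
  simp only [FirstOrder.Language.Formula.realize_equal,
    FirstOrder.Language.Term.realize_func, FirstOrder.Language.Term.realize_var] at this
  exact Subtype.ext this

theorem starFun_embed [Nonempty Y] {n : ℕ} (f : (Fin n → X) → Y) (p : Fin n → X) :
    E.starFun i j f (fun k => E.embed i (p k)) = E.embed j (f p) := by
  refine Subtype.ext ?_
  have := E.emb.map_fun (extendSymbol i j f) (i ∘ p)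
  rw [extendSymbol_apply] at this
  exact this.symm

theorem starFun_const [Nonempty Y] {n : ℕ} (c : Y) (x : Fin n → E.Star i) :
    E.starFun i j (fun _ => c) x = E.embed j c := by
  have h := starFun_comp (E := E) (i := i) (j := j) (l := j) (m := 0) (fun _ => c)
    (fun k => k.elim0) x
  rw [← h, ← starFun_embed (E := E) (i := j) (fun _ => c) (fun k : Fin 0 => k.elim0)]
  congr 1
  exact Subsingleton.elim _ _

theorem starRel_comp [Nonempty Y] {m n : ℕ} (R : Set (Fin m → Y))
    (f : Fin m → (Fin n → X) → Y) (x : Fin n → E.Star i) :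
    (fun k => E.starFun i j (f k) x) ∈ E.starRel j R ↔
      x ∈ E.starRel i {p | (fun k => f k p) ∈ R} := by
  have := transfer (E := E) (i := i) ((FirstOrder.Language.Relations.formula (imageSymbol j R)
    fun k => FirstOrder.Language.Term.func (extendSymbol i j (f k)) FirstOrder.Language.var).iff
    (FirstOrder.Language.Relations.formula (imageSymbol i {p | (fun k => f k p) ∈ R})
      FirstOrder.Language.var)) (fun p => by
        simp only [FirstOrder.Language.Formula.realize_iff, FirstOrder.Language.Formula.realize_rel,
          FirstOrder.Language.Term.realize_func, FirstOrder.Language.Term.realize_var]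
        have h (k) : FirstOrder.Language.Structure.funMap (extendSymbol i j (f k))
          (fun a => (i ∘ p) a) = j (f k p) := extendSymbol_apply (f k) p
        simp only [h]
        exact (relMap_imageSymbol R fun k => f k p).trans
          (relMap_imageSymbol {p | (fun k => f k p) ∈ R} p).symm) x
  simp only [FirstOrder.Language.Formula.realize_iff, FirstOrder.Language.Formula.realize_rel,
    FirstOrder.Language.Term.realize_func, FirstOrder.Language.Term.realize_var] at this
  exact this

theorem starRel_imp {n : ℕ} {Q R T : Set (Fin n → X)} (h : ∀ p, p ∈ Q → p ∈ R → p ∈ T)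
    {x : Fin n → E.Star i} (hQ : x ∈ E.starRel i Q) (hR : x ∈ E.starRel i R) :
    x ∈ E.starRel i T := by
  have := transfer (E := E) (i := i)
    ((FirstOrder.Language.Relations.formula (imageSymbol i Q) FirstOrder.Language.var).imp
    ((FirstOrder.Language.Relations.formula (imageSymbol i R) FirstOrder.Language.var).imp
    (FirstOrder.Language.Relations.formula (imageSymbol i T) FirstOrder.Language.var))) (fun p => by
        simp only [FirstOrder.Language.Formula.realize_imp, FirstOrder.Language.Formula.realize_rel,
          FirstOrder.Language.Term.realize_var]
        exact fun h1 h2 => (relMap_imageSymbol T p).2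
          (h p ((relMap_imageSymbol Q p).1 h1) ((relMap_imageSymbol R p).1 h2))) x
  simp only [FirstOrder.Language.Formula.realize_imp, FirstOrder.Language.Formula.realize_rel,
    FirstOrder.Language.Term.realize_var] at this
  exact this hQ hR

theorem starRel_of_forall {n : ℕ} {R : Set (Fin n → X)} (h : ∀ p, p ∈ R) (x : Fin n → E.Star i) :
    x ∈ E.starRel i R := by
  have := transfer (E := E) (i := i)
    (FirstOrder.Language.Relations.formula (imageSymbol i R) FirstOrder.Language.var) (fun p => by
        simp only [FirstOrder.Language.Formula.realize_rel,
          FirstOrder.Language.Term.realize_var]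
        exact (relMap_imageSymbol R p).2 (h p)) x
  simp only [FirstOrder.Language.Formula.realize_rel, FirstOrder.Language.Term.realize_var] at this
  exact this

/-! ### Ring operations and order on nonstandard extensions -/

instance [Zero X] : Zero (E.Star i) := ⟨E.embed i 0⟩

instance [One X] : One (E.Star i) := ⟨E.embed i 1⟩

instance [CommRing X] : Add (E.Star i) :=
  ⟨fun a b => E.starFun i i (fun p : Fin 2 → X => p 0 + p 1) ![a, b]⟩

instance [CommRing X] : Mul (E.Star i) :=
  ⟨fun a b => E.starFun i i (fun p : Fin 2 → X => p 0 * p 1) ![a, b]⟩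

instance [CommRing X] : Neg (E.Star i) :=
  ⟨fun a => E.starFun i i (fun p : Fin 1 → X => -p 0) ![a]⟩

instance [LT X] : LT (E.Star i) := ⟨fun a b => ![a, b] ∈ E.starRel i {p | p 0 < p 1}⟩

instance [LE X] : LE (E.Star i) := ⟨fun a b => ![a, b] ∈ E.starRel i {p | p 0 ≤ p 1}⟩

theorem starFun_add [CommRing Y] {n : ℕ} (f g : (Fin n → X) → Y) (x : Fin n → E.Star i) :
    E.starFun i j f x + E.starFun i j g x = E.starFun i j (fun p => f p + g p) x := by
  refine Eq.trans ?_ (starFun_comp (E := E) (j := j) (fun p : Fin 2 → Y => p 0 + p 1) ![f, g] x)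
  change E.starFun j j _ _ = _
  congr 1; funext k; fin_cases k <;> rfl

theorem starFun_mul [CommRing Y] {n : ℕ} (f g : (Fin n → X) → Y) (x : Fin n → E.Star i) :
    E.starFun i j f x * E.starFun i j g x = E.starFun i j (fun p => f p * g p) x := by
  refine Eq.trans ?_ (starFun_comp (E := E) (j := j) (fun p : Fin 2 → Y => p 0 * p 1) ![f, g] x)
  change E.starFun j j _ _ = _
  congr 1; funext k; fin_cases k <;> rfl

theorem starFun_neg [CommRing Y] {n : ℕ} (f : (Fin n → X) → Y) (x : Fin n → E.Star i) :
    -E.starFun i j f x = E.starFun i j (fun p => -f p) x := by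
  refine Eq.trans ?_ (starFun_comp (E := E) (j := j) (fun p : Fin 1 → Y => -p 0) ![f] x)
  change E.starFun j j _ _ = _
  congr 1; funext k; fin_cases k; rfl

theorem starFun_lt [LT Y] [Nonempty Y] {n : ℕ} (f g : (Fin n → X) → Y) (x : Fin n → E.Star i) :
    E.starFun i j f x < E.starFun i j g x ↔ x ∈ E.starRel i {p | f p < g p} := by
  have h := starRel_comp (E := E) (j := j) {p : Fin 2 → Y | p 0 < p 1} ![f, g] x
  refine Iff.trans ?_ h
  change _ ∈ E.starRel j _ ↔ _
  have e : ![E.starFun i j f x, E.starFun i j g x] =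
      fun k => E.starFun i j ((![f, g] : Fin 2 → (Fin n → X) → Y) k) x := by
    funext k; fin_cases k <;> rfl
  rw [e]

theorem starFun_le [LE Y] [Nonempty Y] {n : ℕ} (f g : (Fin n → X) → Y) (x : Fin n → E.Star i) :
    E.starFun i j f x ≤ E.starFun i j g x ↔ x ∈ E.starRel i {p | f p ≤ g p} := by
  have h := starRel_comp (E := E) (j := j) {p : Fin 2 → Y | p 0 ≤ p 1} ![f, g] x
  refine Iff.trans ?_ h
  change _ ∈ E.starRel j _ ↔ _
  have e : ![E.starFun i j f x, E.starFun i j g x] =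
      fun k => E.starFun i j ((![f, g] : Fin 2 → (Fin n → X) → Y) k) x := by
    funext k; fin_cases k <;> rfl
  rw [e]

theorem starFun_congr [Nonempty Y] {n : ℕ} {f g : (Fin n → X) → Y} (h : ∀ p, f p = g p)
    (x : Fin n → E.Star i) : E.starFun i j f x = E.starFun i j g x := by rw [funext h]

theorem zero_eq_starFun [CommRing X] {n : ℕ} (x : Fin n → E.Star i) :
    (0 : E.Star i) = E.starFun i i (fun _ => 0) x := (starFun_const 0 x).symm

theorem one_eq_starFun [CommRing X] {n : ℕ} (x : Fin n → E.Star i) :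
    (1 : E.Star i) = E.starFun i i (fun _ => 1) x := (starFun_const 1 x).symm

/-- `*X` is a commutative ring if `X` is one, by transfer of the ring axioms. -/
instance [CommRing X] : CommRing (E.Star i) := CommRing.ofMinimalAxioms
  (by
    intro a b c
    change ![a, b, c] 0 + ![a, b, c] 1 + ![a, b, c] 2 = ![a, b, c] 0 + (![a, b, c] 1 + ![a, b, c] 2)
    simp only [← starFun_proj (E := E) (i := i) _ ![a, b, c], starFun_add]
    exact starFun_congr (fun p => add_assoc _ _ _) _)
  (by
    intro a
    change 0 + ![a] 0 = ![a] 0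
    rw [zero_eq_starFun ![a] ]
    simp only [← starFun_proj (E := E) (i := i) _ ![a], starFun_add]
    exact starFun_congr (fun p => zero_add _) _)
  (by
    intro a
    change -![a] 0 + ![a] 0 = 0
    rw [zero_eq_starFun ![a] ]
    simp only [← starFun_proj (E := E) (i := i) _ ![a], starFun_add, starFun_neg]
    exact starFun_congr (fun p => neg_add_cancel _) _)
  (by
    intro a b c
    change ![a, b, c] 0 * ![a, b, c] 1 * ![a, b, c] 2 = ![a, b, c] 0 * (![a, b, c] 1 * ![a, b, c] 2)
    simp only [← starFun_proj (E := E) (i := i) _ ![a, b, c], starFun_mul]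
    exact starFun_congr (fun p => mul_assoc _ _ _) _)
  (by
    intro a b
    change ![a, b] 0 * ![a, b] 1 = ![a, b] 1 * ![a, b] 0
    simp only [← starFun_proj (E := E) (i := i) _ ![a, b], starFun_mul]
    exact starFun_congr (fun p => mul_comm _ _) _)
  (by
    intro a
    change 1 * ![a] 0 = ![a] 0
    rw [one_eq_starFun ![a] ]
    simp only [← starFun_proj (E := E) (i := i) _ ![a], starFun_mul]
    exact starFun_congr (fun p => one_mul _) _)
  (by
    intro a b c
    change ![a, b, c] 0 * (![a, b, c] 1 + ![a, b, c] 2) =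
      ![a, b, c] 0 * ![a, b, c] 1 + ![a, b, c] 0 * ![a, b, c] 2
    simp only [← starFun_proj (E := E) (i := i) _ ![a, b, c], starFun_mul, starFun_add]
    exact starFun_congr (fun p => mul_add _ _ _) _)

end NonstandardExtension

/-! ### The nonstandard number field and its adelic subquotient -/

namespace NonstandardAdele

open NumberField NonstandardExtension Topology Filter IsDedekindDomain

/-- The places of a number field: the Archimedean and the non-Archimedean ones. -/
abbrev Place (K : Type*) [Field K] [NumberField K] := InfinitePlace K ⊕ FinitePlace K

/-- The (normalized) absolute value `|·|_v` on `K` of a place `v`. -/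
def Place.abv {K : Type*} [Field K] [NumberField K] : Place K → AbsoluteValue K ℝ
  | .inl v => v.1
  | .inr v => v.1

/-- The set of Archimedean places. -/
def Arch (K : Type*) [Field K] [NumberField K] : Set (Place K) := Set.range Sum.inl

theorem abv_add_le_one {K : Type*} [Field K] [NumberField K] {v : Place K} (hv : v ∉ Arch K)
    {a b : K} (ha : v.abv a ≤ 1) (hb : v.abv b ≤ 1) : v.abv (a + b) ≤ 1 := by
  rcases v with v | v
  · exact absurd ⟨v, rfl⟩ hv
  · exact (FinitePlace.add_le v a b).trans (max_le ha hb)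

variable {K : Type*} [Field K] [NumberField K] {S : Type u} (E : NonstandardExtension.{u, w} S)
  (iK : K ↪ S) (iR : ℝ ↪ S)

/-- The extension `|·|_v : *K → *ℝ` of the absolute value of a standard place `v`. -/
def starAbv (v : Place K) (x : E.Star iK) : E.Star iR :=
  E.starFun iK iR (fun p : Fin 1 → K => v.abv (p 0)) ![x]

variable {E iK iR}

theorem starAbv_starFun (v : Place K) {n : ℕ} (f : (Fin n → K) → K) (x : Fin n → E.Star iK) :
    starAbv E iK iR v (E.starFun iK iK f x) = E.starFun iK iR (fun p => v.abv (f p)) x := by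
  refine Eq.trans ?_ (starFun_comp (E := E) (j := iK) (fun p : Fin 1 → K => v.abv (p 0))
    (fun _ => f) x)
  unfold starAbv
  congr 1; funext k; fin_cases k; rfl

theorem starAbv_starFun_lt (v : Place K) {n : ℕ} (f : (Fin n → K) → K) (x : Fin n → E.Star iK)
    (r : ℝ) : starAbv E iK iR v (E.starFun iK iK f x) < E.embed iR r ↔
      x ∈ E.starRel iK {p | v.abv (f p) < r} := by
  rw [starAbv_starFun, ← starFun_const (E := E) (i := iK) r x, starFun_lt]

theorem starAbv_starFun_le (v : Place K) {n : ℕ} (f : (Fin n → K) → K) (x : Fin n → E.Star iK)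
    (r : ℝ) : starAbv E iK iR v (E.starFun iK iK f x) ≤ E.embed iR r ↔
      x ∈ E.starRel iK {p | v.abv (f p) ≤ r} := by
  rw [starAbv_starFun, ← starFun_const (E := E) (i := iK) r x, starFun_le]

theorem starAbv_lt_of (v : Place K) (f : (Fin 2 → K) → K) {r s t : ℝ}
    (h : ∀ p : Fin 2 → K, v.abv (p 0) < r → v.abv (p 1) < s → v.abv (f p) < t) {x y : E.Star iK}
    (hx : starAbv E iK iR v x < E.embed iR r) (hy : starAbv E iK iR v y < E.embed iR s) :
    starAbv E iK iR v (E.starFun iK iK f ![x, y]) < E.embed iR t := by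
  rw [starAbv_starFun_lt]
  refine starRel_imp h ((starAbv_starFun_lt (iR := iR) v _ _ _).1 ?_)
    ((starAbv_starFun_lt (iR := iR) v _ _ _).1 ?_)
  · rw [starFun_proj]; exact hx
  · rw [starFun_proj]; exact hy

theorem starAbv_le_of (v : Place K) (f : (Fin 2 → K) → K) {r s t : ℝ}
    (h : ∀ p : Fin 2 → K, v.abv (p 0) ≤ r → v.abv (p 1) ≤ s → v.abv (f p) ≤ t) {x y : E.Star iK}
    (hx : starAbv E iK iR v x ≤ E.embed iR r) (hy : starAbv E iK iR v y ≤ E.embed iR s) :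
    starAbv E iK iR v (E.starFun iK iK f ![x, y]) ≤ E.embed iR t := by
  rw [starAbv_starFun_le]
  refine starRel_imp h ((starAbv_starFun_le (iR := iR) v _ _ _).1 ?_)
    ((starAbv_starFun_le (iR := iR) v _ _ _).1 ?_)
  · rw [starFun_proj]; exact hx
  · rw [starFun_proj]; exact hy

theorem starAbv_add_lt {v : Place K} {r s : ℝ} {x y : E.Star iK}
    (hx : starAbv E iK iR v x < E.embed iR r) (hy : starAbv E iK iR v y < E.embed iR s) :
    starAbv E iK iR v (x + y) < E.embed iR (r + s) :=
  starAbv_lt_of v (fun p => p 0 + p 1)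
    (fun p h0 h1 => (v.abv.add_le (p 0) (p 1)).trans_lt (add_lt_add h0 h1)) hx hy

theorem starAbv_mul_lt {v : Place K} {r s : ℝ} {x y : E.Star iK}
    (hx : starAbv E iK iR v x < E.embed iR r) (hy : starAbv E iK iR v y < E.embed iR s) :
    starAbv E iK iR v (x * y) < E.embed iR (r * s) :=
  starAbv_lt_of v (fun p => p 0 * p 1)
    (fun p h0 h1 => (v.abv.map_mul (p 0) (p 1)).trans_lt
      (mul_lt_mul'' h0 h1 (v.abv.nonneg _) (v.abv.nonneg _))) hx hy

theorem starAbv_add_le_one {v : Place K} (hv : v ∉ Arch K) {x y : E.Star iK}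
    (hx : starAbv E iK iR v x ≤ 1) (hy : starAbv E iK iR v y ≤ 1) :
    starAbv E iK iR v (x + y) ≤ 1 :=
  starAbv_le_of v (fun p => p 0 + p 1) (fun _ h0 h1 => abv_add_le_one hv h0 h1) hx hy

theorem starAbv_mul_le_one {v : Place K} {x y : E.Star iK}
    (hx : starAbv E iK iR v x ≤ 1) (hy : starAbv E iK iR v y ≤ 1) :
    starAbv E iK iR v (x * y) ≤ 1 :=
  starAbv_le_of v (fun p => p 0 * p 1)
    (fun p h0 h1 => (v.abv.map_mul (p 0) (p 1)).trans_le
      (mul_le_one₀ h0 (v.abv.nonneg _) h1)) hx hy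

theorem starAbv_neg (v : Place K) (x : E.Star iK) :
    starAbv E iK iR v (-x) = starAbv E iK iR v x := by
  refine (starAbv_starFun v (fun p : Fin 1 → K => -p 0) ![x]).trans ?_
  exact starFun_congr (fun p => v.abv.map_neg _) _

theorem starAbv_embed (v : Place K) (a : K) :
    starAbv E iK iR v (E.embed iK a) = E.embed iR (v.abv a) := by
  refine Eq.trans ?_
    (starFun_embed (E := E) (i := iK) (j := iR) (fun p : Fin 1 → K => v.abv (p 0)) ![a])
  unfold starAbv
  congr 1; funext k; fin_cases k; rfl

theorem embed_lt {r s : ℝ} (h : r < s) : E.embed iR r < E.embed iR s := by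
  rw [← starFun_const (E := E) (i := iR) r ![0], ← starFun_const (E := E) (i := iR) s ![0],
    starFun_lt]
  exact starRel_of_forall (fun _ => h) _

theorem embed_le {r s : ℝ} (h : r ≤ s) : E.embed iR r ≤ E.embed iR s := by
  rw [← starFun_const (E := E) (i := iR) r ![0], ← starFun_const (E := E) (i := iR) s ![0],
    starFun_le]
  exact starRel_of_forall (fun _ => h) _

theorem starAbv_zero (v : Place K) : starAbv E iK iR v 0 = E.embed iR 0 := by
  have := starAbv_embed (E := E) (iK := iK) (iR := iR) v 0
  rwa [v.abv.map_zero] at this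

theorem starAbv_one (v : Place K) : starAbv E iK iR v 1 = E.embed iR 1 := by
  have := starAbv_embed (E := E) (iK := iK) (iR := iR) v 1
  rwa [v.abv.map_one] at this

variable (E iK iR)

/-- The uniform structure on `*K` generated by the entourages `{(x, y) | |x - y|_v < ε}`
for all places `v` of `K` and all standard real `ε > 0`. -/
@[reducible]
def starUniformSpace : UniformSpace (E.Star iK) := .ofCore {
  uniformity := ⨅ (v : Place K) (ε : ℝ) (_ : 0 < ε),
    𝓟 {z | starAbv E iK iR v (z.1 - z.2) < E.embed iR ε}
  refl := by
    refine le_iInf fun v => le_iInf fun ε => le_iInf fun hε => principal_mono.2 ?_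
    rintro ⟨x, y⟩ hxy
    obtain rfl : x = y := hxy
    change starAbv E iK iR v (x - x) < _
    rw [sub_self, starAbv_zero]
    exact embed_lt hε
  symm := by
    simp only [tendsto_iInf, tendsto_principal]
    intro v ε hε
    refine mem_iInf_of_mem v (mem_iInf_of_mem ε (mem_iInf_of_mem hε ?_))
    rintro ⟨x, y⟩ hxy
    change starAbv E iK iR v (y - x) < _
    rw [← starAbv_neg, neg_sub]
    exact hxy
  comp := by
    refine le_iInf fun v => le_iInf fun ε => le_iInf fun hε => ?_
    refine (lift'_le (mem_iInf_of_mem v (mem_iInf_of_mem (ε / 2)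
      (mem_iInf_of_mem (half_pos hε) (mem_principal_self _)))) (principal_mono.2 ?_))
    rintro ⟨x, z⟩ ⟨y, hxy, hyz⟩
    have := starAbv_add_lt hxy hyz
    rw [add_halves, sub_add_sub_cancel] at this
    exact this }

/-- `fin_V(*K)`: the elements of `*K` whose absolute value is finite at all places of `K`. -/
def finV : Subring (E.Star iK) where
  carrier := {x | ∀ v : Place K, ∃ r : ℝ, starAbv E iK iR v x < E.embed iR r}
  zero_mem' v := ⟨1, by rw [starAbv_zero]; exact embed_lt one_pos⟩
  one_mem' v := ⟨2, by rw [starAbv_one]; exact embed_lt one_lt_two⟩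
  add_mem' hx hy v := let ⟨_, hr⟩ := hx v; let ⟨_, hs⟩ := hy v; ⟨_, starAbv_add_lt hr hs⟩
  mul_mem' hx hy v := let ⟨_, hr⟩ := hx v; let ⟨_, hs⟩ := hy v; ⟨_, starAbv_mul_lt hr hs⟩
  neg_mem' hx v := let ⟨r, hr⟩ := hx v; ⟨r, by rwa [starAbv_neg]⟩

/-- `fin_{V,T}(*K)`: the elements `x` of `fin_V(*K)` with `|x|_v ≤ 1` for all `v ∉ T ∪ Arch`. -/
def finVS (T : Finset (Place K)) : Subring (E.Star iK) where
  carrier := {x | x ∈ finV E iK iR ∧ ∀ v : Place K, v ∉ (T : Set (Place K)) ∪ Arch K →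
    starAbv E iK iR v x ≤ 1}
  zero_mem' := ⟨zero_mem _, fun v _ => by rw [starAbv_zero]; exact embed_le zero_le_one⟩
  one_mem' := ⟨one_mem _, fun v _ => by rw [starAbv_one]; exact embed_le le_rfl⟩
  add_mem' hx hy := ⟨add_mem hx.1 hy.1, fun v hv =>
    starAbv_add_le_one (fun h => hv (Or.inr h)) (hx.2 v hv) (hy.2 v hv)⟩
  mul_mem' hx hy := ⟨mul_mem hx.1 hy.1, fun v hv => starAbv_mul_le_one (hx.2 v hv) (hy.2 v hv)⟩
  neg_mem' hx := ⟨neg_mem hx.1, fun v hv => by rw [starAbv_neg]; exact hx.2 v hv⟩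

/-- `fin'_V(*K)`: the direct limit (directed union) of the subrings `fin_{V,T}(*K)` over all finite
sets `T` of places. -/
def finV' : Subring (E.Star iK) := ⨆ T : Finset (Place K), finVS E iK iR T

variable {E iK iR} in
theorem mem_finV' {x : E.Star iK} :
    x ∈ finV' E iK iR ↔ ∃ T : Finset (Place K), x ∈ finVS E iK iR T := by
  classical
  refine Subring.mem_iSup_of_directed fun T T' => ⟨T ∪ T', ?_, ?_⟩
  · exact fun x hx => ⟨hx.1, fun v hv => hx.2 v fun h => hv (h.imp_left fun h => by simp_all)⟩
  · exact fun x hx => ⟨hx.1, fun v hv => hx.2 v fun h => hv (h.imp_left fun h => by simp_all)⟩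

/-- `fin_{V,T}(*K)` carries the subspace topology of `*K`. -/
instance finVSTopology (T : Finset (Place K)) : TopologicalSpace (finVS E iK iR T) :=
  (starUniformSpace E iK iR).toTopologicalSpace.induced Subtype.val

/-- `fin'_V(*K)` carries the final topology with respect to the inclusions of all
`fin_{V,T}(*K)`. -/
instance finV'Topology : TopologicalSpace (finV' E iK iR) :=
  ⨆ T : Finset (Place K), (finVSTopology E iK iR T).coinduced
    (Subring.inclusion (le_iSup (finVS E iK iR) T))

/-- `inf_V(*K)`: the elements whose absolute value is infinitesimal at all places of `K`, as an
ideal of `fin'_V(*K)`. -/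
def infV : Ideal (finV' E iK iR) where
  carrier := {x | ∀ (v : Place K) (ε : ℝ), 0 < ε → starAbv E iK iR v x < E.embed iR ε}
  zero_mem' v ε hε := by
    rw [ZeroMemClass.coe_zero, starAbv_zero]; exact embed_lt hε
  add_mem' hx hy v ε hε := by
    have := starAbv_add_lt (hx v (ε / 2) (half_pos hε)) (hy v (ε / 2) (half_pos hε))
    rw [add_halves] at this
    exact this
  smul_mem' c x hx v ε hε := by
    obtain ⟨T, hT⟩ := mem_finV'.1 c.2
    obtain ⟨r, hr⟩ := hT.1 v
    refine starAbv_lt_of v (fun p => p 0 * p 1) (s := ε / (|r| + 1)) (fun p h0 h1 => ?_) hr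
      (hx v _ (by positivity))
    have h2 : v.abv (p 0) < |r| + 1 := h0.trans ((le_abs_self r).trans_lt (lt_add_one _))
    calc v.abv (p 0 * p 1) = v.abv (p 0) * v.abv (p 1) := v.abv.map_mul _ _
      _ < (|r| + 1) * (ε / (|r| + 1)) := mul_lt_mul'' h2 h1 (v.abv.nonneg _) (v.abv.nonneg _)
      _ = ε := mul_div_cancel₀ _ (by positivity)

/-- The adele `a` is the standard part of `x ∈ *K` at all places `v`: whenever `k ∈ K` satisfies
`|a_v - k|_v < ε` in `K_v`, also `|x - k|_v < ε` in `*K`. -/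
def IsStandardPart (x : E.Star iK) (a : AdeleRing (𝓞 K) K) : Prop :=
  (∀ (v : InfinitePlace K) (k : K) (ε : ℝ), ‖a.1 v - algebraMap K v.Completion k‖ < ε →
    starAbv E iK iR (.inl v) (x - E.embed iK k) < E.embed iR ε) ∧
  (∀ (v : HeightOneSpectrum (𝓞 K)) (k : K) (ε : ℝ),
    ‖a.2 v - algebraMap K (v.adicCompletion K) k‖ < ε →
      starAbv E iK iR (.inr (FinitePlace.mk v)) (x - E.embed iK k) < E.embed iR ε)

end NonstandardAdele

end

open NonstandardAdele NumberField

/-! A point of `*K` is studied through its type, the ultrafilter of subsets of `K` whose extension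
contains it: `|x|_v < r` for standard `r` means `|·|_v < r` on a set of this ultrafilter. If `x` is
finite at `v`, the image ultrafilter in `K_v` contains a closed ball, which is compact, so it
converges; its limit is the standard part of `x` at `v` (`tendsto_stdPart`). Limits respect ring
operations, and `|x|_v ≤ 1` outside a finite set makes almost all standard parts integral, so they
form an adele. This is the homomorphism `stdAdele`; it kills exactly the elements infinitesimal at
all places.

Surjectivity (`stdAdele_surjective`) combines weak approximation at finitely many places with
countable saturation, there being only countably many places and radii `1/(n+1)`. At a
non-Archimedean place the closed unit ball is open, so an integral standard part forces `|x|_v ≤ 1`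
exactly; hence the point found lies in some `fin_{V,T}`.

The topological core is `isInducing_stdAdele`: the final topology on `fin'_V` is the one pulled back
from the adeles. Continuity is checked on each `fin_{V,T}`. Conversely, the adeles integral outside
`T` form an open set whose preimage is `fin_{V,T}`, and there the topology is given by finitely many
conditions `|x - y|_v < ε`. All topological claims then follow formally from having an inducing
surjection onto a locally compact Hausdorff ring. -/

namespace NonstandardExtension

open Filter

/-! ### Types of nonstandard points, and countable saturation. -/

section Ultrafilter

variable {S : Type u} {E : NonstandardExtension.{u, w} S} {X Y : Type*} {i : X ↪ S} {j : Y ↪ S}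

theorem notMem_starRel_empty {n : ℕ} (x : Fin n → E.Star i) : x ∉ E.starRel i ∅ := by
  have := transfer (E := E) (i := i) (FirstOrder.Language.Formula.not
    (FirstOrder.Language.Relations.formula (imageSymbol i (∅ : Set (Fin n → X)))
      FirstOrder.Language.var)) (fun p => by
        simp only [FirstOrder.Language.Formula.realize_not,
          FirstOrder.Language.Formula.realize_rel, FirstOrder.Language.Term.realize_var]
        exact fun h => (relMap_imageSymbol ∅ p).1 h) x
  simp only [FirstOrder.Language.Formula.realize_not, FirstOrder.Language.Formula.realize_rel,
    FirstOrder.Language.Term.realize_var] at this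
  exact this

theorem starRel_or_compl {n : ℕ} (R : Set (Fin n → X)) (x : Fin n → E.Star i) :
    x ∈ E.starRel i R ∨ x ∈ E.starRel i Rᶜ := by
  have := transfer (E := E) (i := i)
    (FirstOrder.Language.Relations.formula (imageSymbol i R) FirstOrder.Language.var ⊔
      FirstOrder.Language.Relations.formula (imageSymbol i Rᶜ) FirstOrder.Language.var) (fun p => by
        simp only [FirstOrder.Language.Formula.realize_sup,
          FirstOrder.Language.Formula.realize_rel, FirstOrder.Language.Term.realize_var]
        exact (em (p ∈ R)).imp (relMap_imageSymbol R p).2 (relMap_imageSymbol Rᶜ p).2) x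
  simp only [FirstOrder.Language.Formula.realize_sup, FirstOrder.Language.Formula.realize_rel,
    FirstOrder.Language.Term.realize_var] at this
  exact this

/-- The type of a tuple of nonstandard points: the ultrafilter of all standard relations whose
extension contains the tuple. -/
def starUltrafilter {n : ℕ} (x : Fin n → E.Star i) : Ultrafilter (Fin n → X) :=
  .ofComplNotMemIff
    { sets := {R | x ∈ E.starRel i R}
      univ_sets := starRel_of_forall (fun _ => Set.mem_univ _) x
      sets_of_superset := fun h hle => starRel_imp (fun _ hp _ => hle hp) h h
      inter_sets := fun {Q R} hQ hR =>
        starRel_imp (T := Q ∩ R) (fun _ hp hq => And.intro hp hq) hQ hR }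
    fun R => .intro (fun h => (starRel_or_compl R x).resolve_right h) fun h h' =>
      notMem_starRel_empty x
        (starRel_imp (T := ∅) (fun p (hp : p ∈ R) (hq : p ∈ Rᶜ) => hq hp) h h')

theorem mem_starUltrafilter {n : ℕ} {x : Fin n → E.Star i} {R : Set (Fin n → X)} :
    R ∈ (starUltrafilter x : Filter (Fin n → X)) ↔ x ∈ E.starRel i R := Iff.rfl

/-- Extended functions act on types by pushforward; this is what turns statements about `*K` into
statements about limits along filters. -/
theorem starUltrafilter_starFun [Nonempty Y] {m n : ℕ} (f : Fin m → (Fin n → X) → Y)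
    (x : Fin n → E.Star i) :
    (starUltrafilter (fun k => E.starFun i j (f k) x) : Filter (Fin m → Y)) =
      map (fun p k => f k p) (starUltrafilter x) :=
  Filter.ext fun R => starRel_comp R f x

theorem starUltrafilter_embed [Nonempty X] {n : ℕ} (p : Fin n → X) :
    (starUltrafilter (fun k => E.embed i (p k)) : Filter (Fin n → X)) = pure p := by
  -- A standard tuple is the value of constant functions of zero variables, and the pushforward of a
  -- proper filter under a constant map is principal.
  have := starUltrafilter_starFun (E := E) (i := i) (j := i)
    (fun k (_ : Fin 0 → X) => p k) (fun k => k.elim0)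
  simp only [starFun_const] at this
  rw [this, Filter.map_const]

theorem starUltrafilter_single [Nonempty Y] {n : ℕ} (f : (Fin n → X) → Y) (x : Fin n → E.Star i) :
    (starUltrafilter ![E.starFun i j f x] : Filter (Fin 1 → Y)) =
      map (fun p _ => f p) (starUltrafilter x) := by
  rw [← starUltrafilter_starFun (fun _ => f) x]
  congr 2
  funext k; fin_cases k; rfl

theorem relMap_iff_vec_one {M : Type*} [(fullLanguage S).Structure M]
    (R : (fullLanguage S).Relations 1) (s : Fin 1 → M) :
    FirstOrder.Language.Structure.RelMap R s ↔ FirstOrder.Language.Structure.RelMap R ![s 0] := by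
  rw [show s = ![s 0] from funext fun k => by fin_cases k; rfl]
  rfl

/-- Countable saturation for extensions of countably many standard sets. -/
theorem exists_forall_mem_starRel [Nonempty X] {ι : Type*} [Countable ι] (A : ι → Set X)
    (hA : ∀ F : Finset ι, ∃ a, ∀ k ∈ F, a ∈ A k) :
    ∃ x : E.Star i, ∀ k, ![x] ∈ E.starRel i {p | p 0 ∈ A k} := by
  classical
  rcases isEmpty_or_nonempty ι with _ | _
  · exact ⟨E.embed i (Classical.arbitrary X), fun k => isEmptyElim k⟩
  obtain ⟨e, he⟩ := exists_surjective_nat ι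
  -- Intersecting with the domain predicate keeps the point supplied by saturation inside `*X`.
  let D : ℕ → Set E.carrier := fun n =>
    {x | FirstOrder.Language.Structure.RelMap (domSymbol i) ![x]} ∩
      {x | FirstOrder.Language.Structure.RelMap (imageSymbol i {p : Fin 1 → X | p 0 ∈ A (e n)}) ![x]}
  have hdef (R : (fullLanguage S).Relations 1) : (Set.univ : Set E.carrier).Definable₁
      (fullLanguage S) {x | FirstOrder.Language.Structure.RelMap R ![x]} := by
    refine ⟨(FirstOrder.Language.LHom.onFormula (FirstOrder.Language.lhomWithConstants _ _)
      (FirstOrder.Language.Relations.formula₁ R (FirstOrder.Language.var 0))), ?_⟩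
    ext x
    simp only [Set.mem_ofPred_eq, FirstOrder.Language.LHom.realize_onFormula,
      FirstOrder.Language.Formula.realize_rel₁]
    rfl
  obtain ⟨x, hx⟩ := E.countably_saturated D
    (fun n => Set.Definable.inter (hdef _) (hdef _)) (fun n => by
      obtain ⟨a, ha⟩ := hA ((Finset.range (n + 1)).image e)
      refine ⟨(E.embed i a).1, Set.mem_iInter₂.2 fun k hk => ⟨(E.embed i a).2, ?_⟩⟩
      have : {p : Fin 1 → X | p 0 ∈ A (e k)} ∈
          (starUltrafilter (fun _ : Fin 1 => E.embed i a) : Filter (Fin 1 → X)) := by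
        rw [starUltrafilter_embed]
        exact ha _ (Finset.mem_image_of_mem e (Finset.mem_range.2 (Nat.lt_succ_of_le hk)))
      have h : FirstOrder.Language.Structure.RelMap _ _ := mem_starUltrafilter.1 this
      exact (relMap_iff_vec_one _ _).1 h)
  rw [Set.mem_iInter] at hx
  refine ⟨⟨x, (hx 0).1⟩, fun k => ?_⟩
  obtain ⟨n, rfl⟩ := he k
  exact (relMap_iff_vec_one _ _).2 (hx n).2

end Ultrafilter

end NonstandardExtension

namespace NonstandardAdele

open NumberField NonstandardExtension Topology Filter IsDedekindDomain

/-! ### Local compactness of the completions and of the adele ring. -/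

section LocalFields

variable {K : Type*} [Field K] [NumberField K]

open scoped Valued

/-- The finite ring `𝓞 K / v` surjects onto the residue field: an integral element of `K_v` is
congruent to some `k ∈ K` by density, and `k`, being integral at `v`, is congruent to an element of
`𝓞 K`. -/
instance residueField_adicCompletion_finite (v : HeightOneSpectrum (𝓞 K)) :
    Finite 𝓀[v.adicCompletion K] := by
  let A := v.adicCompletionIntegers K
  let f : 𝓞 K →+* IsLocalRing.ResidueField A := (IsLocalRing.residue A).comp (algebraMap (𝓞 K) A)
  have key (x : A) : IsLocalRing.residue A x = 0 ↔ Valued.v (x : v.adicCompletion K) < 1 := by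
    rw [IsLocalRing.residue_eq_zero_iff, IsLocalRing.mem_maximalIdeal, mem_nonunits_iff,
      HeightOneSpectrum.adicCompletionIntegers.isUnit_iff_valued_eq_one]
    exact ⟨fun h => lt_of_le_of_ne x.2 h, fun h => h.ne⟩
  have hker (a : 𝓞 K) (ha : a ∈ v.asIdeal) : f a = 0 := by
    refine (key _).2 ?_
    rw [HeightOneSpectrum.algebraMap_adicCompletionIntegers_apply,
      HeightOneSpectrum.valuedAdicCompletion_eq_valuation']
    exact (v.valuation_lt_one_iff_mem a).2 ha
  have hsurj : Function.Surjective f := by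
    intro y
    obtain ⟨x, rfl⟩ := IsLocalRing.residue_surjective y
    have hopen : IsOpen {z : v.adicCompletion K | Valued.v (z - (x : v.adicCompletion K)) < 1} := by
      simp_rw [← Valued.toNormedField.norm_lt_one_iff]
      exact isOpen_lt (by fun_prop) continuous_const
    obtain ⟨k, hk⟩ := (HeightOneSpectrum.denseRange_algebraMap (R := 𝓞 K) K v).exists_mem_open hopen
      ⟨(x : v.adicCompletion K), by simp⟩
    have hk' : Valued.v (algebraMap K (v.adicCompletion K) k - x) < 1 := hk
    have hx : Valued.v (x : v.adicCompletion K) ≤ 1 := x.2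
    have hk1 : v.valuation K k ≤ 1 := by
      rw [← HeightOneSpectrum.valuedAdicCompletion_eq_valuation']
      have := Valued.v.map_add_le hk'.le hx
      rwa [sub_add_cancel] at this
    obtain ⟨a, ha⟩ := v.exists_valuation_sub_lt_of_integer hk1 1
    refine ⟨a, sub_eq_zero.1 ?_⟩
    rw [RingHom.comp_apply, ← map_sub, key]
    rw [← HeightOneSpectrum.valuedAdicCompletion_eq_valuation'] at ha
    have := Valued.v.map_add_lt (g := 1) ha hk'
    convert this using 2
    change _ = algebraMap K (v.adicCompletion K) (algebraMap (𝓞 K) K a - k) + _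
    rw [map_sub, sub_add_sub_cancel]
    rfl
  have : Finite (𝓞 K ⧸ v.asIdeal) := v.asIdeal.finiteQuotientOfFreeOfNeBot v.ne_bot
  exact Finite.of_surjective _ (Ideal.Quotient.lift_surjective_of_surjective v.asIdeal hker hsurj)

instance properSpace_adicCompletion (v : HeightOneSpectrum (𝓞 K)) :
    ProperSpace (v.adicCompletion K) := by
  rw [Valued.integer.properSpace_iff_completeSpace_and_isDiscreteValuationRing_integer_and_finite_residueField]
  exact ⟨inferInstance, inferInstanceAs (IsDiscreteValuationRing (v.adicCompletionIntegers K)),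
    inferInstance⟩

theorem adicCompletionIntegers_eq_closedBall (v : HeightOneSpectrum (𝓞 K)) :
    (v.adicCompletionIntegers K : Set (v.adicCompletion K)) = Metric.closedBall 0 1 := by
  exact Valued.toNormedField.setOfPred_mem_integer_eq_closedBall

/-- The local integer rings are open, and compact because they are closed balls in a proper space.
-/
instance locallyCompactSpace_finiteAdeleRing : LocallyCompactSpace (FiniteAdeleRing (𝓞 K) K) := by
  have : Fact (∀ v : HeightOneSpectrum (𝓞 K),
      IsOpen (v.adicCompletionIntegers K : Set (v.adicCompletion K))) :=
    ⟨fun _ ↦ Valued.isOpen_valuationSubring _⟩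
  refine RestrictedProduct.locallyCompactSpace_of_addGroup
    (fun v : HeightOneSpectrum (𝓞 K) => v.adicCompletion K) (.of_forall fun v => ?_)
  rw [adicCompletionIntegers_eq_closedBall]
  exact isCompact_closedBall _ _

instance locallyCompactSpace_adeleRing : LocallyCompactSpace (AdeleRing (𝓞 K) K) :=
  inferInstanceAs (LocallyCompactSpace (InfiniteAdeleRing K × FiniteAdeleRing (𝓞 K) K))

instance t2Space_adeleRing : T2Space (AdeleRing (𝓞 K) K) := by
  have : T2Space (InfiniteAdeleRing K) :=
    inferInstanceAs (T2Space ((v : InfinitePlace K) → v.Completion))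
  have : T2Space (FiniteAdeleRing (𝓞 K) K) := inferInstanceAs (T2Space
    (RestrictedProduct (fun v : HeightOneSpectrum (𝓞 K) => v.adicCompletion K)
      (fun v => (v.adicCompletionIntegers K : Set (v.adicCompletion K))) cofinite))
  exact inferInstanceAs (T2Space (InfiniteAdeleRing K × FiniteAdeleRing (𝓞 K) K))

theorem continuous_eval_infinite (v : InfinitePlace K) :
    Continuous fun a : AdeleRing (𝓞 K) K => a.1 v :=
  (continuous_apply v).comp (continuous_fst (X := InfiniteAdeleRing K) (Y := FiniteAdeleRing (𝓞 K) K))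

theorem continuous_eval_finite (v : HeightOneSpectrum (𝓞 K)) :
    Continuous fun a : AdeleRing (𝓞 K) K => a.2 v :=
  (RestrictedProduct.continuous_eval v).comp
    (continuous_snd (X := InfiniteAdeleRing K) (Y := FiniteAdeleRing (𝓞 K) K))

/-- With `T` the finite places in the index set, the preimage of this set under `stdAdele` is a
stage `fin_{V,T}`, which is therefore open. -/
theorem isOpen_integral_outside (T : Set (HeightOneSpectrum (𝓞 K))) :
    IsOpen {a : AdeleRing (𝓞 K) K | ∀ v, v ∉ T → a.2 v ∈ v.adicCompletionIntegers K} :=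
  (RestrictedProduct.isOpen_forall_imp_mem
    (fun v : HeightOneSpectrum (𝓞 K) => Valued.isOpen_valuationSubring (v.adicCompletion K))
      (p := fun v => v ∉ T)).preimage
    (continuous_snd (X := InfiniteAdeleRing K) (Y := FiniteAdeleRing (𝓞 K) K))

end LocalFields

/-! ### Countability of the places and weak approximation. -/

section Places

variable {K : Type*} [Field K] [NumberField K]

instance countable_numberField : Countable K := by
  have := Module.Free.chooseBasis ℚ K |>.equivFun.toEquiv
  exact this.injective.countable

/-- Saturation handles only countable families. Each ideal of the Noetherian ring `𝓞 K` is spanned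
by a finite subset of a countable set. -/
instance countable_place : Countable (Place K) := by
  have : Countable (Ideal (𝓞 K)) := by
    have h : Function.Surjective fun s : Finset (𝓞 K) => Ideal.span (s : Set (𝓞 K)) :=
      fun I => IsNoetherian.noetherian I
    have : Countable (𝓞 K) := RingOfIntegers.coe_injective.countable
    exact h.countable
  have : Countable (HeightOneSpectrum (𝓞 K)) :=
    (HeightOneSpectrum.asIdeal_injective (R := 𝓞 K)).countable
  have : Countable (FinitePlace K) := FinitePlace.equivHeightOneSpectrum.injective.countable
  infer_instance

theorem abv_isNontrivial (v : Place K) : v.abv.IsNontrivial := by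
  rcases v with v | v
  · exact v.isNontrivial
  · obtain ⟨x, hx, hx0⟩ := Submodule.exists_mem_ne_zero_of_ne_bot v.maximalIdeal.ne_bot
    refine ⟨x, by simpa using hx0, ne_of_lt ?_⟩
    change v x < 1
    rw [← FinitePlace.norm_embedding_eq]
    exact (FinitePlace.norm_lt_one_iff_mem K _ x).2 hx

theorem finitePlace_natCast_le_one (v : FinitePlace K) (n : ℕ) : v (n : K) ≤ 1 := by
  rw [← FinitePlace.norm_embedding_eq]
  simpa using FinitePlace.norm_le_one K v.maximalIdeal (n : 𝓞 K)

/-- The integer 2 separates them: its absolute value is 2 at `v` and at most 1 at `w`. -/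
theorem infinitePlace_not_isEquiv_finitePlace (v : InfinitePlace K) (w : FinitePlace K) :
    ¬ v.1.IsEquiv w.1 := fun h => by
  have h1 : v ((2 : ℕ) : K) ≤ 1 := h.le_one_iff.2 (finitePlace_natCast_le_one w 2)
  rw [InfinitePlace.map_natCast] at h1
  norm_num at h1

/-- The prime is recovered as the set of integers of absolute value less than 1, which depends only
on the equivalence class. -/
theorem finitePlace_eq_of_isEquiv {v w : FinitePlace K} (h : v.1.IsEquiv w.1) : v = w := by
  rw [← FinitePlace.mk_maximalIdeal v, ← FinitePlace.mk_maximalIdeal w, FinitePlace.mk_eq_iff]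
  ext x
  rw [← FinitePlace.norm_lt_one_iff_mem K, ← FinitePlace.norm_lt_one_iff_mem K,
    FinitePlace.norm_embedding_eq, FinitePlace.norm_embedding_eq]
  exact h.lt_one_iff

theorem abv_not_isEquiv {v w : Place K} (h : v ≠ w) : ¬ v.abv.IsEquiv w.abv := by
  rcases v with v | v <;> rcases w with w | w
  · exact fun h' => h (congrArg _ (InfinitePlace.eq_iff_isEquiv.2 h'))
  · exact infinitePlace_not_isEquiv_finitePlace v w
  · exact fun h' => infinitePlace_not_isEquiv_finitePlace w v h'.symm
  · exact fun h' => h (congrArg _ (finitePlace_eq_of_isEquiv h'))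

/-- Weak approximation at finitely many places of a number field. -/
theorem exists_abv_sub_lt (F : Finset (Place K)) (a : Place K → K) {ε : ℝ} (hε : 0 < ε) :
    ∃ k : K, ∀ v ∈ F, v.abv (k - a v) < ε := by
  -- Artin–Whaples: `K` is dense in the finite product of its copies topologized by pairwise
  -- inequivalent nontrivial absolute values.
  have h := AbsoluteValue.denseRange_algebraMap_pi (v := fun v : F => v.1.abv)
    (fun v => abv_isNontrivial v.1) (fun v w hvw => abv_not_isEquiv fun h => hvw (Subtype.ext h))
  obtain ⟨k, hk⟩ := Metric.denseRange_iff.1 h (fun v => WithAbs.toAbs _ (a v.1)) ε hε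
  refine ⟨k, fun v hv => ?_⟩
  have := (dist_pi_lt_iff hε).1 hk ⟨v, hv⟩
  rw [dist_comm, dist_eq_norm] at this
  exact this

end Places

/-! ### Standard parts in a single completion. -/

section

variable {K : Type*} [Field K] {S : Type u} {E : NonstandardExtension.{u, w} S} {iK : K ↪ S}
  {F : Type*} [NormedField F]

/-- The standard part of `x ∈ *K` in a field `F` containing `K`. -/
noncomputable def stdPart (φ : K →+* F) (x : E.Star iK) : F :=
  limUnder (starUltrafilter ![x] : Filter (Fin 1 → K)) fun p => φ (p 0)

/-- Since `limUnder` takes an arbitrary value when there is no limit, computing a standard part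
means exhibiting a limit; here it may be taken along the joint type of several points. -/
theorem stdPart_starFun {φ : K →+* F} {n : ℕ} {f : (Fin n → K) → K} {x : Fin n → E.Star iK} {a : F}
    (h : Tendsto (fun p => φ (f p)) (starUltrafilter x) (𝓝 a)) :
    stdPart φ (E.starFun iK iK f x) = a := by
  refine Tendsto.limUnder_eq ?_
  rw [starUltrafilter_single]
  exact tendsto_map'_iff.2 h

theorem stdPart_embed (φ : K →+* F) (k : K) : stdPart φ (E.embed iK k) = φ k := by
  rw [← starFun_const (E := E) (i := iK) k ![0] ]
  exact stdPart_starFun tendsto_const_nhds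

theorem stdPart_eq_of_eventually {φ : K →+* F} {x : E.Star iK} {a : F}
    (h : ∀ ε > 0, ∀ᶠ p : Fin 1 → K in starUltrafilter ![x], ‖φ (p 0) - a‖ < ε) :
    stdPart φ x = a :=
  Tendsto.limUnder_eq (Metric.tendsto_nhds.2 fun ε hε => by simpa only [dist_eq_norm] using h ε hε)

end

variable {K : Type*} [Field K] [NumberField K] {S : Type u} {E : NonstandardExtension.{u, w} S}
  {iK : K ↪ S} {iR : ℝ ↪ S}

theorem starAbv_lt_iff_eventually {v : Place K} {x : E.Star iK} {r : ℝ} :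
    starAbv E iK iR v x < E.embed iR r ↔
      ∀ᶠ p : Fin 1 → K in starUltrafilter ![x], v.abv (p 0) < r := by
  have h := starAbv_starFun_lt (iR := iR) v (fun p : Fin 1 → K => p 0) ![x] r
  rwa [starFun_proj] at h

theorem starAbv_le_iff_eventually {v : Place K} {x : E.Star iK} {r : ℝ} :
    starAbv E iK iR v x ≤ E.embed iR r ↔
      ∀ᶠ p : Fin 1 → K in starUltrafilter ![x], v.abv (p 0) ≤ r := by
  have h := starAbv_starFun_le (iR := iR) v (fun p : Fin 1 → K => p 0) ![x] r
  rwa [starFun_proj] at h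

section StdPart

variable {F : Type*} [NormedField F] [ProperSpace F] {φ : K →+* F} {v : Place K}

/-- Finiteness at `v` puts the pushed-forward ultrafilter on a closed ball, which is compact, so it
converges. -/
theorem tendsto_stdPart (hφ : ∀ k, ‖φ k‖ = v.abv k) {x : E.Star iK}
    (hx : ∃ r, starAbv E iK iR v x < E.embed iR r) :
    Tendsto (fun p : Fin 1 → K => φ (p 0)) (starUltrafilter ![x]) (𝓝 (stdPart φ x)) := by
  obtain ⟨r, hr⟩ := hx
  rw [starAbv_lt_iff_eventually] at hr
  obtain ⟨a, -, ha⟩ := (isCompact_closedBall (0 : F) r).ultrafilter_le_nhds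
    ((starUltrafilter ![x]).map fun p : Fin 1 → K => φ (p 0)) (le_principal_iff.2
      (hr.mono fun p hp => mem_closedBall_zero_iff.2 ((hφ _).trans_le hp.le)))
  exact tendsto_nhds_limUnder ⟨a, ha⟩

/-- Sums and products need both limits along one filter, the joint type, whose projections are the
types of the single points. -/
theorem tendsto_stdPart_proj (hφ : ∀ k, ‖φ k‖ = v.abv k) {n : ℕ} {x : Fin n → E.Star iK} (k : Fin n)
    (hx : ∃ r, starAbv E iK iR v (x k) < E.embed iR r) :
    Tendsto (fun p : Fin n → K => φ (p k)) (starUltrafilter x) (𝓝 (stdPart φ (x k))) := by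
  have h := tendsto_stdPart hφ hx
  have e := starUltrafilter_single (E := E) (i := iK) (j := iK) (fun p : Fin n → K => p k) x
  rw [starFun_proj] at e
  rw [e] at h
  exact tendsto_map'_iff.1 h

theorem stdPart_add (hφ : ∀ k, ‖φ k‖ = v.abv k) {x y : E.Star iK}
    (hx : ∃ r, starAbv E iK iR v x < E.embed iR r)
    (hy : ∃ r, starAbv E iK iR v y < E.embed iR r) :
    stdPart φ (x + y) = stdPart φ x + stdPart φ y := by
  refine stdPart_starFun (f := fun p => p 0 + p 1) (x := ![x, y]) ?_
  simp only [map_add]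
  exact (tendsto_stdPart_proj hφ (x := ![x, y]) 0 hx).add
    (tendsto_stdPart_proj hφ (x := ![x, y]) 1 hy)

theorem stdPart_mul (hφ : ∀ k, ‖φ k‖ = v.abv k) {x y : E.Star iK}
    (hx : ∃ r, starAbv E iK iR v x < E.embed iR r)
    (hy : ∃ r, starAbv E iK iR v y < E.embed iR r) :
    stdPart φ (x * y) = stdPart φ x * stdPart φ y := by
  refine stdPart_starFun (f := fun p => p 0 * p 1) (x := ![x, y]) ?_
  simp only [map_mul]
  exact (tendsto_stdPart_proj hφ (x := ![x, y]) 0 hx).mul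
    (tendsto_stdPart_proj hφ (x := ![x, y]) 1 hy)

theorem stdPart_neg (hφ : ∀ k, ‖φ k‖ = v.abv k) {x : E.Star iK}
    (hx : ∃ r, starAbv E iK iR v x < E.embed iR r) :
    stdPart φ (-x) = -stdPart φ x := by
  refine stdPart_starFun (f := fun p => -p 0) (x := ![x]) ?_
  simp only [map_neg]
  exact (tendsto_stdPart hφ hx).neg

theorem stdPart_sub (hφ : ∀ k, ‖φ k‖ = v.abv k) {x y : E.Star iK}
    (hx : ∃ r, starAbv E iK iR v x < E.embed iR r)
    (hy : ∃ r, starAbv E iK iR v y < E.embed iR r) :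
    stdPart φ (x - y) = stdPart φ x - stdPart φ y := by
  rw [sub_eq_add_neg, stdPart_add hφ hx (iR := iR) (by simpa only [starAbv_neg] using hy),
    stdPart_neg hφ hy, ← sub_eq_add_neg]

theorem starAbv_lt_of_norm_stdPart_lt (hφ : ∀ k, ‖φ k‖ = v.abv k) {x : E.Star iK}
    (hx : ∃ r, starAbv E iK iR v x < E.embed iR r) {ε : ℝ} (h : ‖stdPart φ x‖ < ε) :
    starAbv E iK iR v x < E.embed iR ε := by
  rw [starAbv_lt_iff_eventually]
  filter_upwards [(tendsto_stdPart hφ hx).norm.eventually_lt_const h] with p hp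
  rwa [hφ] at hp

/-- Only weak inequalities survive the limit, whence the halved radii in later estimates. -/
theorem norm_stdPart_le_of_starAbv_le (hφ : ∀ k, ‖φ k‖ = v.abv k) {x : E.Star iK}
    (hx : ∃ r, starAbv E iK iR v x < E.embed iR r) {ε : ℝ}
    (h : starAbv E iK iR v x ≤ E.embed iR ε) : ‖stdPart φ x‖ ≤ ε := by
  rw [starAbv_le_iff_eventually] at h
  refine le_of_tendsto (tendsto_stdPart hφ hx).norm ?_
  filter_upwards [h] with p hp
  rwa [hφ]

/-- In an ultrametric field the closed unit ball is open, so it is a neighbourhood of the limit and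
belongs to the ultrafilter. At Archimedean places this fails. -/
theorem starAbv_le_one_of_norm_stdPart_le [IsUltrametricDist F]
    (hφ : ∀ k, ‖φ k‖ = v.abv k) {x : E.Star iK}
    (hx : ∃ r, starAbv E iK iR v x < E.embed iR r) (h : ‖stdPart φ x‖ ≤ 1) :
    starAbv E iK iR v x ≤ E.embed iR 1 := by
  rw [starAbv_le_iff_eventually]
  have hopen : Metric.closedBall (0 : F) 1 ∈ 𝓝 (stdPart φ x) :=
    (IsUltrametricDist.isOpen_closedBall 0 one_ne_zero).mem_nhds (by simpa using h)
  filter_upwards [tendsto_stdPart hφ hx hopen] with p hp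
  simpa [hφ] using hp

theorem stdPart_eq_zero_iff (hφ : ∀ k, ‖φ k‖ = v.abv k) {x : E.Star iK}
    (hx : ∃ r, starAbv E iK iR v x < E.embed iR r) :
    stdPart φ x = 0 ↔ ∀ ε > 0, starAbv E iK iR v x < E.embed iR ε := by
  refine ⟨fun h ε hε => starAbv_lt_of_norm_stdPart_lt hφ hx (by simpa [h] using hε), fun h => ?_⟩
  refine norm_le_zero_iff.1 (le_of_forall_pos_le_add fun ε hε => ?_)
  rw [zero_add]
  refine norm_stdPart_le_of_starAbv_le hφ hx ?_
  rw [starAbv_le_iff_eventually]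
  filter_upwards [starAbv_lt_iff_eventually.1 (h ε hε)] with p hp using hp.le

end StdPart
-- The completion embeds isometrically, with closed image, into `ℂ`.
instance properSpace_completion (v : InfinitePlace K) : ProperSpace v.Completion where
  isCompact_closedBall x r := by
    have h := InfinitePlace.Completion.isometry_extensionEmbedding v
    rw [← h.preimage_closedBall]
    exact h.isClosedEmbedding.isCompact_preimage (isCompact_closedBall _ _)

instance isUltrametricDist_adicCompletion (v : HeightOneSpectrum (𝓞 K)) :
    IsUltrametricDist (v.adicCompletion K) := by
  open scoped Valued in infer_instance

theorem norm_algebraMap_completion (v : InfinitePlace K) (k : K) :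
    ‖algebraMap K v.Completion k‖ = Place.abv (.inl v) k :=
  InfinitePlace.Completion.norm_coe v _

theorem norm_algebraMap_adicCompletion (v : HeightOneSpectrum (𝓞 K)) (k : K) :
    ‖algebraMap K (v.adicCompletion K) k‖ = Place.abv (.inr (FinitePlace.mk v)) k := rfl

theorem mem_adicCompletionIntegers_iff_norm_le_one {v : HeightOneSpectrum (𝓞 K)}
    {a : v.adicCompletion K} : a ∈ v.adicCompletionIntegers K ↔ ‖a‖ ≤ 1 := by
  rw [← SetLike.mem_coe, adicCompletionIntegers_eq_closedBall, mem_closedBall_zero_iff]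

/-! ### The standard part homomorphism to the adeles and its kernel. -/

theorem exists_starAbv_lt_of_mem_finV' (x : finV' E iK iR) (v : Place K) :
    ∃ r, starAbv E iK iR v x < E.embed iR r := by
  obtain ⟨T, hT⟩ := mem_finV'.1 x.2
  exact hT.1 v

theorem eventually_mem_adicCompletionIntegers_stdPart (x : finV' E iK iR) :
    ∀ᶠ v : HeightOneSpectrum (𝓞 K) in cofinite,
      stdPart (algebraMap K (v.adicCompletion K)) (x : E.Star iK) ∈ v.adicCompletionIntegers K := by
  obtain ⟨T, hT⟩ := mem_finV'.1 x.2
  have hinj : Function.Injective fun v : HeightOneSpectrum (𝓞 K) =>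
      (Sum.inr (FinitePlace.mk v) : Place K) :=
    Sum.inr_injective.comp FinitePlace.equivHeightOneSpectrum.symm.injective
  -- Non-integral standard parts occur only at primes whose place lies in `T`.
  refine (T.finite_toSet.preimage hinj.injOn).subset fun v hv => ?_
  by_contra hvT
  refine hv (mem_adicCompletionIntegers_iff_norm_le_one.2
    (norm_stdPart_le_of_starAbv_le (norm_algebraMap_adicCompletion v) (hT.1 _) (hT.2 _ ?_)))
  rintro (h | ⟨_, h⟩)
  exacts [hvT h, by cases h]

/-- The map taking standard parts at all places. -/
noncomputable def stdAdele : finV' E iK iR →+* AdeleRing (𝓞 K) K where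
  toFun x := (fun v => stdPart (algebraMap K v.Completion) (x : E.Star iK),
    ⟨fun v => stdPart (algebraMap K (v.adicCompletion K)) (x : E.Star iK),
      eventually_mem_adicCompletionIntegers_stdPart x⟩)
  map_one' := Prod.ext
    (funext fun _ => (stdPart_embed (E := E) (iK := iK) _ 1).trans (map_one _))
    (FiniteAdeleRing.ext K fun _ => (stdPart_embed (E := E) (iK := iK) _ 1).trans (map_one _))
  map_zero' := Prod.ext
    (funext fun _ => (stdPart_embed (E := E) (iK := iK) _ 0).trans (map_zero _))
    (FiniteAdeleRing.ext K fun _ => (stdPart_embed (E := E) (iK := iK) _ 0).trans (map_zero _))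
  map_add' x y := Prod.ext
    (funext fun v => stdPart_add (norm_algebraMap_completion v)
      (exists_starAbv_lt_of_mem_finV' x _) (exists_starAbv_lt_of_mem_finV' y _))
    (FiniteAdeleRing.ext K fun v => stdPart_add (norm_algebraMap_adicCompletion v)
      (exists_starAbv_lt_of_mem_finV' x _) (exists_starAbv_lt_of_mem_finV' y _))
  map_mul' x y := Prod.ext
    (funext fun v => stdPart_mul (norm_algebraMap_completion v)
      (exists_starAbv_lt_of_mem_finV' x _) (exists_starAbv_lt_of_mem_finV' y _))
    (FiniteAdeleRing.ext K fun v => stdPart_mul (norm_algebraMap_adicCompletion v)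
      (exists_starAbv_lt_of_mem_finV' x _) (exists_starAbv_lt_of_mem_finV' y _))

theorem forall_finitePlace {P : FinitePlace K → Prop} :
    (∀ w, P w) ↔ ∀ v, P (FinitePlace.mk v) :=
  FinitePlace.equivHeightOneSpectrum.symm.surjective.forall

theorem stdAdele_eq_zero_iff {x : finV' E iK iR} : stdAdele x = 0 ↔
    (∀ v : InfinitePlace K, stdPart (algebraMap K v.Completion) (x : E.Star iK) = 0) ∧
    ∀ v : HeightOneSpectrum (𝓞 K),
      stdPart (algebraMap K (v.adicCompletion K)) (x : E.Star iK) = 0 :=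
  ⟨fun h => ⟨fun v => congrFun (congrArg Prod.fst h) v,
      fun v => DFunLike.congr_fun (congrArg Prod.snd h) v⟩,
    fun h => Prod.ext (funext h.1) (FiniteAdeleRing.ext K h.2)⟩

theorem ker_stdAdele : RingHom.ker (stdAdele (E := E) (iK := iK) (iR := iR)) = infV E iK iR := by
  ext x
  have hinf (v : InfinitePlace K) := stdPart_eq_zero_iff (norm_algebraMap_completion v)
    (exists_starAbv_lt_of_mem_finV' x (.inl v))
  have hfin (v : HeightOneSpectrum (𝓞 K)) := stdPart_eq_zero_iff (norm_algebraMap_adicCompletion v)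
    (exists_starAbv_lt_of_mem_finV' x (.inr (FinitePlace.mk v)))
  rw [RingHom.mem_ker, stdAdele_eq_zero_iff, forall_congr' hinf, forall_congr' hfin]
  change _ ↔ ∀ (v : Place K) (ε : ℝ), 0 < ε → starAbv E iK iR v x < E.embed iR ε
  rw [Sum.forall, forall_finitePlace]

theorem norm_stdPart_sub_embed {F : Type*} [NormedField F] [ProperSpace F] {φ : K →+* F}
    {v : Place K} (hφ : ∀ k, ‖φ k‖ = v.abv k) (x : finV' E iK iR) {k : K} {ε : ℝ}
    (h : ‖stdPart φ (x : E.Star iK) - φ k‖ < ε) :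
    starAbv E iK iR v (x - E.embed iK k) < E.embed iR ε := by
  have hk : ∃ r, starAbv E iK iR v (E.embed iK k) < E.embed iR r :=
    ⟨v.abv k + 1, by rw [starAbv_embed]; exact embed_lt (lt_add_one _)⟩
  have hx := exists_starAbv_lt_of_mem_finV' x v
  refine starAbv_lt_of_norm_stdPart_lt hφ ?_ ?_
  · rw [sub_eq_add_neg]
    obtain ⟨r, hr⟩ := hx
    obtain ⟨s, hs⟩ := hk
    exact ⟨r + s, starAbv_add_lt hr (by rwa [starAbv_neg])⟩
  · rwa [stdPart_sub hφ hx hk, stdPart_embed]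

theorem isStandardPart_stdAdele (x : finV' E iK iR) : IsStandardPart E iK iR x (stdAdele x) :=
  ⟨fun v _ _ h => norm_stdPart_sub_embed (norm_algebraMap_completion v) x h,
    fun v _ _ h => norm_stdPart_sub_embed (norm_algebraMap_adicCompletion v) x h⟩

/-! ### Surjectivity -/

/-- Replaces a target in the completion by a nearby target in `K`, the form that weak approximation
accepts; half of `ε` is spent on this replacement. -/
theorem exists_norm_sub_lt_half {F : Type*} [NormedField F] {φ : K →+* F} (hd : DenseRange φ)
    {v : Place K} (hφ : ∀ k, ‖φ k‖ = v.abv k) (a : F) {ε : ℝ} (hε : 0 < ε) :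
    ∃ c, ∀ k, v.abv (k - c) < ε / 2 → ‖φ k - a‖ < ε := by
  obtain ⟨c, hc⟩ := Metric.denseRange_iff.1 hd a (ε / 2) (half_pos hε)
  refine ⟨c, fun k hk => ?_⟩
  rw [← hφ, map_sub] at hk
  rw [dist_eq_norm, norm_sub_rev] at hc
  calc ‖φ k - a‖ ≤ ‖φ k - φ c‖ + ‖φ c - a‖ := norm_sub_le_norm_sub_add_norm_sub _ _ _
    _ < ε / 2 + ε / 2 := add_lt_add hk hc
    _ = ε := add_halves ε

/-- The elements of `K` that are `ε`-close to an adele at the place `v`. -/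
def closeAt (a : AdeleRing (𝓞 K) K) (ε : ℝ) : Place K → Set K
  | .inl v => {k | ‖algebraMap K v.Completion k - a.1 v‖ < ε}
  | .inr w => {k | ‖algebraMap K (w.maximalIdeal.adicCompletion K) k - a.2 w.maximalIdeal‖ < ε}

theorem closeAt_mk (a : AdeleRing (𝓞 K) K) (ε : ℝ) (v : HeightOneSpectrum (𝓞 K)) :
    closeAt a ε (.inr (FinitePlace.mk v)) =
      {k | ‖algebraMap K (v.adicCompletion K) k - a.2 v‖ < ε} := by
  simp only [closeAt]
  rw [FinitePlace.maximalIdeal_mk]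

theorem closeAt_mono (a : AdeleRing (𝓞 K) K) {ε δ : ℝ} (h : ε ≤ δ) (v : Place K) :
    closeAt a ε v ⊆ closeAt a δ v := by
  rcases v with v | v <;> exact fun _ hk => lt_of_lt_of_le hk h

theorem exists_mem_closeAt (a : AdeleRing (𝓞 K) K) {ε : ℝ} (hε : 0 < ε) (F : Finset (Place K)) :
    ∃ k, ∀ v ∈ F, k ∈ closeAt a ε v := by
  have h (v : Place K) : ∃ c, ∀ k, v.abv (k - c) < ε / 2 → k ∈ closeAt a ε v := by
    rcases v with v | w
    · have hd : DenseRange (algebraMap K v.Completion) :=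
        (InfinitePlace.Completion.denseRange_coe v).comp
          (WithAbs.equiv v.1).symm.surjective.denseRange (InfinitePlace.Completion.continuous_coe v)
      exact exists_norm_sub_lt_half hd (norm_algebraMap_completion v) (a.1 v) hε
    · obtain ⟨v, rfl⟩ := FinitePlace.equivHeightOneSpectrum.symm.surjective w
      rw [show FinitePlace.equivHeightOneSpectrum.symm v = FinitePlace.mk v from rfl, closeAt_mk]
      exact exists_norm_sub_lt_half (HeightOneSpectrum.denseRange_algebraMap K v)
        (norm_algebraMap_adicCompletion v) (a.2 v) hε
  choose c hc using h
  obtain ⟨k, hk⟩ := exists_abv_sub_lt F c (half_pos hε)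
  exact ⟨k, fun v hv => hc v k (hk v hv)⟩

/-- Saturation applied to the sets of points `1/(n+1)`-close to `a` at `v`, over all pairs `(v, n)`;
weak approximation gives the finite intersection property. -/
theorem exists_star_close (a : AdeleRing (𝓞 K) K) : ∃ x : E.Star iK, ∀ (v : Place K) (ε : ℝ),
    0 < ε → ∀ᶠ p : Fin 1 → K in starUltrafilter ![x], p 0 ∈ closeAt a ε v := by
  classical
  obtain ⟨x, hx⟩ := exists_forall_mem_starRel (E := E) (i := iK)
    (fun q : Place K × ℕ => closeAt a (1 / ((q.2 : ℝ) + 1)) q.1) (fun F => by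
      -- The largest index occurring in `F` gives the smallest radius, which serves for all pairs at
      -- once.
      obtain ⟨k, hk⟩ := exists_mem_closeAt a (ε := 1 / (((F.sup Prod.snd : ℕ) : ℝ) + 1))
        (by positivity) (F.image Prod.fst)
      refine ⟨k, fun q hq => closeAt_mono a ?_ _ (hk q.1 (Finset.mem_image_of_mem _ hq))⟩
      gcongr
      exact Finset.le_sup (f := Prod.snd) hq)
  refine ⟨x, fun v ε hε => ?_⟩
  obtain ⟨n, hn⟩ := exists_nat_one_div_lt hε
  exact mem_of_superset (mem_starUltrafilter.2 (hx (v, n)))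
    fun p hp => closeAt_mono a hn.le v hp

theorem exists_starAbv_lt_of_eventually {F : Type*} [NormedField F] {φ : K →+* F} {v : Place K}
    (hφ : ∀ k, ‖φ k‖ = v.abv k) {x : E.Star iK} {a : F}
    (h : ∀ᶠ p : Fin 1 → K in starUltrafilter ![x], ‖φ (p 0) - a‖ < 1) :
    ∃ r, starAbv E iK iR v x < E.embed iR r := by
  refine ⟨1 + ‖a‖, starAbv_lt_iff_eventually.2 ?_⟩
  filter_upwards [h] with p hp
  rw [← hφ]
  calc ‖φ (p 0)‖ ≤ ‖φ (p 0) - a‖ + ‖a‖ := norm_le_norm_sub_add _ _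
    _ < 1 + ‖a‖ := by gcongr

theorem stdAdele_surjective : Function.Surjective (stdAdele (E := E) (iK := iK) (iR := iR)) := by
  classical
  intro a
  obtain ⟨x, hx⟩ := exists_star_close (E := E) (iK := iK) a
  have hinf (v : InfinitePlace K) := hx (.inl v)
  have hfin (v : HeightOneSpectrum (𝓞 K)) := hx (.inr (FinitePlace.mk v))
  simp only [closeAt_mk] at hfin
  have hst1 (v : InfinitePlace K) : stdPart (algebraMap K v.Completion) x = a.1 v :=
    stdPart_eq_of_eventually (hinf v)
  have hst2 (v : HeightOneSpectrum (𝓞 K)) : stdPart (algebraMap K (v.adicCompletion K)) x = a.2 v :=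
    stdPart_eq_of_eventually (hfin v)
  have hxV : x ∈ finV E iK iR := by
    change ∀ v : Place K, _
    rw [Sum.forall, forall_finitePlace]
    exact ⟨fun v => exists_starAbv_lt_of_eventually (norm_algebraMap_completion v)
        (hinf v 1 one_pos),
      fun v => exists_starAbv_lt_of_eventually (norm_algebraMap_adicCompletion v)
        (hfin v 1 one_pos)⟩
  have hT : {v : HeightOneSpectrum (𝓞 K) | a.2 v ∉ v.adicCompletionIntegers K}.Finite := a.2.2
  -- The finite exceptional set consists of the places where `a` is not integral.
  have hxT : x ∈ finVS E iK iR (hT.toFinset.image fun v => .inr (FinitePlace.mk v)) := by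
    refine ⟨hxV, ?_⟩
    rw [Sum.forall, forall_finitePlace]
    refine ⟨fun v hv => absurd (Or.inr ⟨v, rfl⟩) hv, fun v hv => ?_⟩
    refine starAbv_le_one_of_norm_stdPart_le (norm_algebraMap_adicCompletion v) (hxV _) ?_
    rw [hst2, ← mem_adicCompletionIntegers_iff_norm_le_one]
    by_contra h
    exact hv (Or.inl (Finset.mem_coe.2 (Finset.mem_image_of_mem _ (hT.mem_toFinset.2 h))))
  exact ⟨⟨x, mem_finV'.2 ⟨_, hxT⟩⟩, Prod.ext (funext hst1) (FiniteAdeleRing.ext K hst2)⟩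

/-! ### Topology -/

theorem nhds_star (x : E.Star iK) :
    @nhds _ (starUniformSpace E iK iR).toTopologicalSpace x = ⨅ (v : Place K) (ε : ℝ) (_ : 0 < ε),
      𝓟 {y | starAbv E iK iR v (x - y) < E.embed iR ε} := by
  let := starUniformSpace E iK iR
  rw [nhds_eq_comap_uniformity]
  change comap _ (⨅ (v : Place K) (ε : ℝ) (_ : 0 < ε),
    𝓟 {z : E.Star iK × E.Star iK | starAbv E iK iR v (z.1 - z.2) < E.embed iR ε}) = _
  simp only [comap_iInf, comap_principal]
  rfl

theorem continuous_stdPart_finVS {F : Type*} [NormedField F] [ProperSpace F] {φ : K →+* F}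
    {v : Place K} (hφ : ∀ k, ‖φ k‖ = v.abv k) (T : Finset (Place K)) :
    Continuous fun x : finVS E iK iR T => stdPart φ (x : E.Star iK) := by
  refine continuous_iff_continuousAt.2 fun x => Metric.tendsto_nhds.2 fun ε hε => ?_
  rw [show 𝓝 x = comap Subtype.val (@nhds _ (starUniformSpace E iK iR).toTopologicalSpace x) from
    @nhds_induced _ _ (starUniformSpace E iK iR).toTopologicalSpace _ _, nhds_star]
  refine mem_of_superset (preimage_mem_comap (mem_iInf_of_mem v (mem_iInf_of_mem (ε / 2)
    (mem_iInf_of_mem (half_pos hε) (mem_principal_self _))))) fun y hy => ?_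
  have hxy : starAbv E iK iR v ((x : E.Star iK) - y) < E.embed iR (ε / 2) := hy
  change dist _ _ < ε
  rw [dist_comm, dist_eq_norm, ← stdPart_sub hφ (x.2.1 v) (y.2.1 v)]
  refine lt_of_le_of_lt (norm_stdPart_le_of_starAbv_le hφ ⟨_, hxy⟩ ?_) (half_lt_self hε)
  rw [starAbv_le_iff_eventually]
  filter_upwards [starAbv_lt_iff_eventually.1 hxy] with p hp using hp.le

/-- On the stage `T` the finite part factors through the restricted product for the principal filter
of the places outside `T`. Its topology is that of the product, so continuity can be checked at each
place. -/
theorem continuous_stdAdele : Continuous (stdAdele (E := E) (iK := iK) (iR := iR)) := by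
  refine continuous_iSup_dom.2 fun T => continuous_coinduced_dom.2 ?_
  have hinf : Continuous fun x : finVS E iK iR T => fun v : InfinitePlace K =>
      stdPart (algebraMap K v.Completion) (x : E.Star iK) :=
    continuous_pi fun v => continuous_stdPart_finVS (norm_algebraMap_completion v) T
  have hinj : Function.Injective fun v : HeightOneSpectrum (𝓞 K) =>
      (Sum.inr (FinitePlace.mk v) : Place K) :=
    Sum.inr_injective.comp FinitePlace.equivHeightOneSpectrum.symm.injective
  let T' : Set (HeightOneSpectrum (𝓞 K)) := {v | Sum.inr (FinitePlace.mk v) ∉ T}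
  have hT' : cofinite ≤ 𝓟 T' := by
    refine le_principal_iff.2 ((T.finite_toSet.preimage hinj.injOn).subset fun v hv => ?_)
    by_contra h
    exact hv h
  let f : finVS E iK iR T → RestrictedProduct (fun v : HeightOneSpectrum (𝓞 K) =>
      v.adicCompletion K) (fun v => (v.adicCompletionIntegers K : Set (v.adicCompletion K))) (𝓟 T') :=
    fun x => ⟨fun v => stdPart (algebraMap K (v.adicCompletion K)) (x : E.Star iK),
      eventually_principal.2 fun v hv => mem_adicCompletionIntegers_iff_norm_le_one.2
        (norm_stdPart_le_of_starAbv_le (norm_algebraMap_adicCompletion v) (x.2.1 _) (x.2.2 _ (by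
          rintro (h | ⟨_, h⟩)
          exacts [hv h, by cases h])))⟩
  have hf : Continuous f := RestrictedProduct.continuous_rng_of_principal_iff_forall.2 fun v =>
    continuous_stdPart_finVS (norm_algebraMap_adicCompletion v) T
  exact (Continuous.prodMk hinf ((RestrictedProduct.continuous_inclusion hT').comp hf) :)

/-- Adeles near that of `x` are integral wherever `x` is required to be, so points above them lie in
the same stage `T`; there, neighbourhoods of `x` are traces of neighbourhoods in `*K`, which
finitely many standard parts control. -/
theorem comap_stdAdele_le_nhds (x : finV' E iK iR) : comap stdAdele (𝓝 (stdAdele x)) ≤ 𝓝 x := by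
  obtain ⟨T, hT⟩ := mem_finV'.1 x.2
  have hmem : {y : finV' E iK iR | (y : E.Star iK) ∈ finVS E iK iR T} ∈
      comap stdAdele (𝓝 (stdAdele x)) := by
    let T' : Set (HeightOneSpectrum (𝓞 K)) := {v | Sum.inr (FinitePlace.mk v) ∈ T}
    refine mem_of_superset (preimage_mem_comap ((isOpen_integral_outside T').mem_nhds
      fun v hv => ?_)) fun y hy => ⟨fun v => exists_starAbv_lt_of_mem_finV' y v, ?_⟩
    · refine mem_adicCompletionIntegers_iff_norm_le_one.2
        (norm_stdPart_le_of_starAbv_le (norm_algebraMap_adicCompletion v) (hT.1 _) (hT.2 _ ?_))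
      rintro (h | ⟨_, h⟩)
      exacts [hv h, by cases h]
    · rw [Sum.forall, forall_finitePlace]
      refine ⟨fun v hv => absurd (Or.inr ⟨v, rfl⟩) hv, fun v hv => ?_⟩
      exact starAbv_le_one_of_norm_stdPart_le (norm_algebraMap_adicCompletion v)
        (exists_starAbv_lt_of_mem_finV' y _)
        (mem_adicCompletionIntegers_iff_norm_le_one.1 (hy v fun h => hv (Or.inl h)))
  have hclose {F : Type _} [NormedField F] [ProperSpace F] {φ : K →+* F} {v : Place K}
      (hφ : ∀ k, ‖φ k‖ = v.abv k) {g : AdeleRing (𝓞 K) K → F} (hg : Continuous g)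
      (hgφ : ∀ y : finV' E iK iR, g (stdAdele y) = stdPart φ (y : E.Star iK)) {ε : ℝ} (hε : 0 < ε) :
      {y : finV' E iK iR | starAbv E iK iR v ((x : E.Star iK) - y) < E.embed iR ε} ∈
        comap stdAdele (𝓝 (stdAdele x)) := by
    refine mem_of_superset (preimage_mem_comap
      (hg.continuousAt.preimage_mem_nhds (Metric.ball_mem_nhds _ hε))) fun y hy => ?_
    have h : dist (g (stdAdele y)) (g (stdAdele x)) < ε := hy
    rw [hgφ, hgφ, dist_comm, dist_eq_norm, ← stdPart_sub hφ (exists_starAbv_lt_of_mem_finV' x _)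
      (exists_starAbv_lt_of_mem_finV' y _)] at h
    exact starAbv_lt_of_norm_stdPart_lt hφ (exists_starAbv_lt_of_mem_finV' (x - y) v) h
  have hle : comap stdAdele (𝓝 (stdAdele x)) ≤ comap (Subtype.val : finV' E iK iR → E.Star iK)
      (@nhds _ (starUniformSpace E iK iR).toTopologicalSpace (x : E.Star iK)) := by
    rw [nhds_star]
    simp only [comap_iInf, comap_principal, le_iInf_iff, le_principal_iff]
    rw [Sum.forall, forall_finitePlace]
    exact ⟨fun v ε hε => hclose (norm_algebraMap_completion v) (continuous_eval_infinite v)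
      (fun _ => rfl) hε, fun v ε hε => hclose (norm_algebraMap_adicCompletion v)
      (continuous_eval_finite v) (fun _ => rfl) hε⟩
  intro s hs
  obtain ⟨U, hUs, hU, hxU⟩ := mem_nhds_iff.1 hs
  -- An open set of the final topology has an open trace on the stage `T`, and that trace is cut out
  -- by an open set `O` of `*K`.
  have hUT : IsOpen (Subring.inclusion (le_iSup (finVS E iK iR) T) ⁻¹' U) :=
    isOpen_coinduced.1 (isOpen_iSup_iff.1 hU T)
  obtain ⟨O, hO, hOU⟩ := @isOpen_induced_iff _ _ (starUniformSpace E iK iR).toTopologicalSpace _ _ |>.1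
    hUT
  have hxO : (x : E.Star iK) ∈ O := by
    have : (⟨x, hT⟩ : finVS E iK iR T) ∈ Subtype.val ⁻¹' O := hOU ▸ hxU
    exact this
  have hO' := hle (preimage_mem_comap
    (@IsOpen.mem_nhds _ (starUniformSpace E iK iR).toTopologicalSpace _ _ hO hxO))
  filter_upwards [hmem, hO'] with y hyT hyO
  have : (⟨y, hyT⟩ : finVS E iK iR T) ∈ Subtype.val ⁻¹' O := hyO
  rw [hOU] at this
  exact hUs this

theorem isInducing_stdAdele : IsInducing (stdAdele (E := E) (iK := iK) (iR := iR)) :=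
  isInducing_iff_nhds.2 fun x => le_antisymm
    (continuous_stdAdele.tendsto x).le_comap (comap_stdAdele_le_nhds x)

end NonstandardAdele

/-! ### Formal consequences of an inducing ring homomorphism. -/

section InducingRingHom

open Topology

variable {R A : Type*} [CommRing R] [TopologicalSpace R] [CommRing A] [TopologicalSpace A]

theorem isTopologicalRing_of_isInducing [IsTopologicalRing A] {f : R →+* A} (hf : IsInducing f) :
    IsTopologicalRing R :=
  have := hf.continuousMul f
  have := hf.continuousAdd f
  have : ContinuousNeg R :=
    ⟨hf.continuous_iff.2 (hf.continuous.neg.congr fun x => (map_neg f x).symm)⟩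
  { }

theorem closure_zero_eq_ker_of_isInducing [T1Space A] {f : R →+* A} (hf : IsInducing f) :
    closure ({0} : Set R) = RingHom.ker f := by
  rw [hf.closure_eq_preimage_closure_image, Set.image_singleton, map_zero, closure_singleton]
  rfl

theorem exists_quotient_ringEquiv_isHomeomorph {f : R →+* A} (hf : IsInducing f)
    (hs : Function.Surjective f) {I : Ideal R} (hI : RingHom.ker f = I) :
    ∃ e : (R ⧸ I) ≃+* A, IsHomeomorph e ∧ ∀ x, e (Ideal.Quotient.mk I x) = f x := by
  subst hI
  refine ⟨RingHom.quotientKerEquivOfSurjective hs, ?_, fun x => rfl⟩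
  have hq : IsQuotientMap (Ideal.Quotient.mk (RingHom.ker f)) := isQuotientMap_quot_mk
  -- The composite `f` is a quotient map, as an inducing surjection; hence so is the second factor,
  -- which is also injective.
  exact isHomeomorph_iff_isQuotientMap_injective.2
    ⟨.of_comp hq.continuous (hq.continuous_iff.2 hf.continuous)
      (hf.isQuotientMap_of_surjective hs), RingEquiv.injective _⟩

/-- An inducing map into a T0 space identifies exactly the inseparable points. For a topological
ring the T0 quotient is already Hausdorff, so `SeparationQuotient` is the maximal Hausdorff
quotient. -/
theorem exists_separationQuotient_ringEquiv_isHomeomorph [IsTopologicalRing R] [T0Space A]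
    {f : R →+* A} (hf : IsInducing f) (hs : Function.Surjective f) :
    ∃ e : SeparationQuotient R ≃+* A, IsHomeomorph e ∧ ∀ x, e (SeparationQuotient.mk x) = f x := by
  let g : SeparationQuotient R →+* A :=
    { toFun := SeparationQuotient.lift f fun _ _ h => (h.map hf.continuous).eq
      map_one' := map_one f
      map_zero' := map_zero f
      map_add' := SeparationQuotient.surjective_mk.forall₂.2 (map_add f)
      map_mul' := SeparationQuotient.surjective_mk.forall₂.2 (map_mul f) }
  have hmk : IsQuotientMap (SeparationQuotient.mk : R → SeparationQuotient R) :=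
    SeparationQuotient.isQuotientMap_mk
  have hg : Function.Bijective g := by
    refine ⟨SeparationQuotient.surjective_mk.forall₂.2 fun x y h => ?_,
      hs.of_comp (g := SeparationQuotient.mk)⟩
    exact SeparationQuotient.mk_eq_mk.2 (hf.inseparable_iff.1 (.of_eq h))
  refine ⟨.ofBijective g hg, ?_, fun x => rfl⟩
  exact isHomeomorph_iff_isQuotientMap_injective.2
    ⟨.of_comp hmk.continuous (hmk.continuous_iff.2 hf.continuous)
      (hf.isQuotientMap_of_surjective hs), RingEquiv.injective _⟩

end InducingRingHom

theorem mainTheorem8 {K : Type*} [Field K] [NumberField K] {S : Type u}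
    (E : NonstandardExtension.{u, w} S) (iK : K ↪ S) (iR : ℝ ↪ S) :
    LocallyCompactSpace (finV' E iK iR) ∧
    ∃ _ : IsTopologicalRing (finV' E iK iR),
    (infV E iK iR : Set (finV' E iK iR)) = closure {0} ∧
    ∃ Φ : finV' E iK iR →+* AdeleRing (𝓞 K) K,
      Continuous Φ ∧ Function.Surjective Φ ∧ RingHom.ker Φ = infV E iK iR ∧
      (∀ x : finV' E iK iR, IsStandardPart E iK iR (x : E.Star iK) (Φ x)) ∧
      (∃ e : (finV' E iK iR ⧸ infV E iK iR) ≃+* AdeleRing (𝓞 K) K,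
        IsHomeomorph e ∧ ∀ x, e (Ideal.Quotient.mk (infV E iK iR) x) = Φ x) ∧
      (∃ e : SeparationQuotient (finV' E iK iR) ≃+* AdeleRing (𝓞 K) K,
        IsHomeomorph e ∧ ∀ x, e (SeparationQuotient.mk x) = Φ x) := by
  have hi := isInducing_stdAdele (E := E) (iK := iK) (iR := iR)
  have hs := stdAdele_surjective (E := E) (iK := iK) (iR := iR)
  have hring : IsTopologicalRing (finV' E iK iR) := isTopologicalRing_of_isInducing hi
  -- Local compactness pulls back along an inducing map with locally closed range; here the range is
  -- everything.
  refine ⟨hi.locallyCompactSpace (by rw [hs.range_eq]; exact isOpen_univ.isLocallyClosed), hring,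
    ?_, stdAdele, hi.continuous, hs, ker_stdAdele, isStandardPart_stdAdele,
    exists_quotient_ringEquiv_isHomeomorph hi hs ker_stdAdele,
    exists_separationQuotient_ringEquiv_isHomeomorph hi hs⟩
  rw [closure_zero_eq_ker_of_isInducing hi, ker_stdAdele]
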